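/- **Setting.** Fix integers $n\ge 1$ (the valence of an extraordinary vertex or face) and $m\ge 1$, and put $N=nm$. A rotationally symmetric, non-stationary subdivision scheme $\mathscr S$ is described as follows. In regular regions it acts by the rules $f^{(k+1)}_\alpha=\sum_{\beta\in\mathbb Z^2}c^{(k)}_{\alpha-2\beta}f^{(k)}_\beta$, $k\ge 1$, with real masks $c^{(k)}$ that have a common finite support. Near the extraordinary element it acts by block-circulant matrices $S_k=\mathrm{Circ}(B_{0,k},\dots,B_{n-1,k})\in\mathbb R^{N\times N}$, $k\ge 1$, with blocks of size $m\times m$. Put $S^{(0)}=I$, $S^{(k)}=S_kS_{k-1}\cdots S_1$, and $d_{k+1}=S^{(k)}d_1$ for initial control points $d_1\in\mathbb R^{N\times 3}$. The scheme *converges in regular regions* if for every bounded $f^{(1)}$ there is a continuous $g:\mathbb R^2\to\mathbb R$ with $\sup_{\alpha\in\mathbb Z^2}|g(2^{-\ell}\alpha)-f^{(\ell+1)}_\alpha|\to 0$ as $\ell\to\infty$, and $g\ne 0$ for at least one $f^{(1)}$. It is *non-singular* if only $f^{(1)}=0$ gives $g=0$. The basic limit function $\phi_k$ is the limit function generated from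 the delta sequence given at level $k$ (by the masks $c^{(k)},c^{(k+1)},\dots$). Let $\Omega_k$ be $\{u,v\ge 0,\ 2^{1-k}\le\max\{u,v\}\le 2^{2-k}\}$ for quadrilateral meshes and $\{u,v\ge 0,\ 2^{1-k}\le u+v\le 2^{2-k}\}$ for triangular meshes; it is the union of three congruent cells $\omega_k^{[1]},\omega_k^{[2]},\omega_k^{[3]}$. On the cell $\omega_{k+1}^{[i]}$ of the sector $l\in\mathbb Z/n\mathbb Z$ the ring $r_{k+1}$ is $$r_{k+1}(u,v)=\sum_{\alpha\in\mathbb Z^2}\phi_{k+1}\big(2^{k}(u,v)-\alpha\big)\,(d_{k+1})_{\pi(l,i,\alpha)}\in\mathbb R^3,$$ where $\pi(l,i,\alpha)$ is the index of the control point at the lattice position $\alpha$ of the regular net that controls this cell; $\pi$ does not depend on $k$ and commutes with the rotation of the sectors. The scheme *converges near the extraordinary element* if it converges in regular regions, all $\phi_k$ exist, and for every $d_1$ there is $r_c\in\mathbb R^3$ with $\sup\|r_k-r_c\|_\infty\to 0$ as $k\to\infty$, the supremum being over all $n$ sectors and all $(u,v)\in\Omega_k$. A stationary scheme is one with $c^{(k)}=c$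 and $S_k=S$ for all $k$. Its matrix $S$ has *no ineffective eigenvectors* if for every complex eigenvector of $S$ with nonzero eigenvalue the first ring with this eigenvector as control points is not identically zero. **Theorem.** Let $\mathscr S$ be a rotationally symmetric, non-singular, non-stationary scheme with masks $c^{(k)}$ and local matrices $S_k$. Let $\bar{\mathscr S}$ be a rotationally symmetric stationary scheme with mask $c$ and local matrix $S$, for the same control-net layout $\pi$ and the same type of mesh, such that $S\mathbf x_0=\mathbf x_0$ for $\mathbf x_0=(1,\dots,1)^T$ and $S$ has no ineffective eigenvectors. Assume that (i) $\bar{\mathscr S}$ converges in regular regions and near the extraordinary element; (ii) $\sum_{k\ge1}\|\mathcal S_{c^{(k)}}-\mathcal S_{c}\|_\infty<\infty$, where $\|\mathcal S_a\|_\infty=\max_{\alpha\in\{0,1\}^2}\sum_{\beta\in\mathbb Z^2}|a_{\alpha-2\beta}|$; (iii) there are a finite constant $C$ and $\sigma>1$ with $\|S_k-S\|_\infty\le C/\sigma^k$ for all $k\ge1$. Then $\mathscr S$ converges near the extraordinary element. Moreover there is exactly one $\tilde{\mathbf x}_0\in\mathbb R^N$ with $S^T\tilde{\mathbf x}_0=\tilde{\mathbf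 x}_0$ and $\tilde{\mathbf x}_0^T\mathbf x_0=1$, and for every $d_1\in\mathbb R^{N\times3}$ the limit $\lim_{k\to\infty}y_k$ of $y_k=\sum_{j=1}^kS^{k-j}(S_j-S)S^{(j-1)}d_1$ exists and $$\lim_{k\to\infty}\ \sup\|r_{k+1}(u,v)-(q_0+\beta_0)\|_\infty=0,\qquad q_0=d_1^T\tilde{\mathbf x}_0,\qquad \beta_0=\Big(\lim_{k\to\infty}y_k\Big)^T\frac{\mathbf x_0}{N},$$ the supremum being over all $n$ sectors and all $(u,v)\in\Omega_{k+1}$. -/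

import Mathlib

open Filter Topology
open scoped Matrix ENNReal Matrix.Norms.Operator

/-! ### Subdivision on the regular lattice -/

/-- A finitely supported real subdivision mask on `ℤ²`. -/
abbrev Mask := (ℤ × ℤ) →₀ ℝ

/-- The subdivision operator of a mask: `(S_c f)_α = ∑_β c_{α - 2β} f_β`. -/
noncomputable def Mask.subdiv (c : Mask) (f : ℤ × ℤ → ℝ) : ℤ × ℤ → ℝ :=
  fun α => ∑ᶠ β : ℤ × ℤ, c (α - 2 • β) * f β

/-- The operator norm of the subdivision operator: the maximum over `α ∈ {0, 1}²` of
`∑_β |c_{α - 2β}|`. -/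
noncomputable def Mask.opNorm (c : Mask) : ℝ :=
  ⨆ e : Fin 2 × Fin 2, ∑ᶠ β : ℤ × ℤ, |c ((((e.1 : ℕ) : ℤ), ((e.2 : ℕ) : ℤ)) - 2 • β)|

/-- A bounded sequence on `ℤ²`. -/
def BoundedData (f : ℤ × ℤ → ℝ) : Prop := ∃ M : ℝ, ∀ α, |f α| ≤ M

/-- The sequence with value `1` at the origin and `0` elsewhere. -/
def deltaData : ℤ × ℤ → ℝ := fun α => if α = 0 then 1 else 0

/-- A lattice point seen in the plane. -/
def latticePoint (α : ℤ × ℤ) : ℝ × ℝ := ((α.1 : ℝ), (α.2 : ℝ))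

/-! ### Block-circulant matrices -/

/-- `Circ(B_0, …, B_{n-1})`: the block in block row `a` and block column `b` is `B_{b - a}`. -/
def blockCirculant {n m : ℕ} (B : ZMod n → Matrix (Fin m) (Fin m) ℝ) :
    Matrix (ZMod n × Fin m) (ZMod n × Fin m) ℝ :=
  Matrix.of fun p q => B (q.1 - p.1) p.2 q.2

/-! ### Rotationally symmetric schemes -/

/-- A rotationally symmetric, local, level-dependent subdivision scheme near an extraordinary
element of valence `n` with `m` control points per sector: at every level `k ≥ 1` a mask, which
acts in regular regions, and the blocks of the block-circulant local subdivision matrix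
`S_k`, which acts in the irregular region.  The masks have a common finite support.
(Level `0` is never used.) -/
structure SubdivisionScheme (n m : ℕ) where
  mask : ℕ → Mask
  block : ℕ → ZMod n → Matrix (Fin m) (Fin m) ℝ
  common_support : ∃ A : Finset (ℤ × ℤ), ∀ k, 1 ≤ k → (mask k).support ⊆ A

/-- The stationary scheme with mask `c` and local matrix `Circ(B_0, …, B_{n-1})`. -/
def stationaryScheme {n m : ℕ} (c : Mask) (B : ZMod n → Matrix (Fin m) (Fin m) ℝ) :
    SubdivisionScheme n m where
  mask := fun _ => c
  block := fun _ => B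
  common_support := ⟨c.support, fun _ _ => Finset.Subset.refl _⟩

/-- Where the control points of the rings sit.  Around the extraordinary element there are `n`
sectors with three cells each.  The control net that determines the patch over a cell is a piece
of the regular lattice `ℤ²`; for the `i`-th cell of sector `0`, `pos i α` is the index
(sector, place in that sector) of the control point at the lattice position `α`.  Only the
positions `α` at which a basic limit function meets the cell play a role. -/
structure ControlNet (n m : ℕ) where
  /-- `true` for a triangular mesh, `false` for a quadrilateral mesh -/
  triangular : Bool
  pos : Fin 3 → ℤ × ℤ → ZMod n × Fin m

/-- The control point at lattice position `α` for the `i`-th cell of sector `l`, by rotation. -/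
def ControlNet.label {n m : ℕ} (net : ControlNet n m) (l : ZMod n) (i : Fin 3) (α : ℤ × ℤ) :
    ZMod n × Fin m :=
  (l + (net.pos i α).1, (net.pos i α).2)

/-- The three cells that make up `Ω₁`: unit squares with union
`{u, v ≥ 0, 1 ≤ max u v ≤ 2}` for quadrilateral meshes, and triangles with union
`{u, v ≥ 0, 1 ≤ u + v ≤ 2}` for triangular meshes. -/
def baseCell : Bool → Fin 3 → Set (ℝ × ℝ)
  | false => ![
      {x | 1 ≤ x.1 ∧ x.1 ≤ 2 ∧ 0 ≤ x.2 ∧ x.2 ≤ 1},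
      {x | 1 ≤ x.1 ∧ x.1 ≤ 2 ∧ 1 ≤ x.2 ∧ x.2 ≤ 2},
      {x | 0 ≤ x.1 ∧ x.1 ≤ 1 ∧ 1 ≤ x.2 ∧ x.2 ≤ 2}]
  | true => ![
      {x | 1 ≤ x.1 ∧ 0 ≤ x.2 ∧ x.1 + x.2 ≤ 2},
      {x | x.1 ≤ 1 ∧ x.2 ≤ 1 ∧ 1 ≤ x.1 + x.2},
      {x | 0 ≤ x.1 ∧ 1 ≤ x.2 ∧ x.1 + x.2 ≤ 2}]

/-- The `i`-th cell of `Ω_{k+1} = 2^{-k} Ω₁`. -/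
def ControlNet.cell {n m : ℕ} (net : ControlNet n m) (k : ℕ) (i : Fin 3) : Set (ℝ × ℝ) :=
  {x | (2 : ℝ) ^ k • x ∈ baseCell net.triangular i}

namespace SubdivisionScheme

variable {n m : ℕ}

/-- The data at level `k + ℓ` obtained from the data `f` at level `k`:
`S_{c^{(k+ℓ-1)}} ⋯ S_{c^{(k)}} f`. -/
noncomputable def refine (S : SubdivisionScheme n m) (k : ℕ) (f : ℤ × ℤ → ℝ) :
    ℕ → ℤ × ℤ → ℝ
  | 0 => f
  | ℓ + 1 => (S.mask (k + ℓ)).subdiv (S.refine k f ℓ)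

/-- `g` is the limit function generated from the data `f` given at level `k`: it is continuous,
and `sup_α |g(2^{-ℓ} α) - f^{(k+ℓ)}_α| → 0` as `ℓ → ∞`. -/
def IsLimit (S : SubdivisionScheme n m) (k : ℕ) (f : ℤ × ℤ → ℝ) (g : ℝ × ℝ → ℝ) : Prop :=
  Continuous g ∧
    Tendsto (fun ℓ : ℕ =>
      ⨆ α : ℤ × ℤ, ‖g (((2 : ℝ) ^ ℓ)⁻¹ • latticePoint α) - S.refine k f ℓ α‖ₑ) atTop (𝓝 0)

/-- Convergence in regular regions. -/
def ConvergentRegular (S : SubdivisionScheme n m) : Prop :=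
  (∀ f, BoundedData f → ∃ g, S.IsLimit 1 f g) ∧
    ∃ f g, BoundedData f ∧ S.IsLimit 1 f g ∧ g ≠ 0

/-- Non-singularity: only the zero sequence generates the zero limit. -/
def NonSingular (S : SubdivisionScheme n m) : Prop :=
  ∀ f, BoundedData f → S.IsLimit 1 f 0 → f = 0

/-- Asymptotical equivalence in regular regions. -/
def AsymptoticallyEquivalent (S T : SubdivisionScheme n m) : Prop :=
  Summable fun k : ℕ => (S.mask (k + 1) - T.mask (k + 1)).opNorm

open Classical in
/-- The `k`-th basic limit function `φ_k`, the (unique) limit function generated from the delta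
sequence given at level `k`; the value `0` is used if there is no limit function. -/
noncomputable def basicLimit (S : SubdivisionScheme n m) (k : ℕ) : ℝ × ℝ → ℝ :=
  if h : ∃ g, S.IsLimit k deltaData g then h.choose else 0

/-- The local subdivision matrix `S_k`. -/
def mat (S : SubdivisionScheme n m) (k : ℕ) : Matrix (ZMod n × Fin m) (ZMod n × Fin m) ℝ :=
  blockCirculant (S.block k)

/-- The product `S^{(k)} = S_k S_{k-1} ⋯ S_1`, with `S^{(0)} = I`. -/
noncomputable def matProd (S : SubdivisionScheme n m) [NeZero n] :
    ℕ → Matrix (ZMod n × Fin m) (ZMod n × Fin m) ℝ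
  | 0 => 1
  | k + 1 => S.mat (k + 1) * S.matProd k

/-- The control points `d_{k+1} = S^{(k)} d_1`. -/
noncomputable def points (S : SubdivisionScheme n m) [NeZero n]
    (d : Matrix (ZMod n × Fin m) (Fin 3) ℝ) (k : ℕ) : Matrix (ZMod n × Fin m) (Fin 3) ℝ :=
  S.matProd k * d

/-- The patch of the ring `r_{k+1}` over the `i`-th cell of `Ω_{k+1}` in sector `l`: the sum of
the control points of level `k + 1`, weighted with the shifts of `φ_{k+1}` on the lattice of
mesh width `2^{-k}`. -/
noncomputable def ring (S : SubdivisionScheme n m) [NeZero n] (net : ControlNet n m)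
    (d : Matrix (ZMod n × Fin m) (Fin 3) ℝ) (k : ℕ) (l : ZMod n) (i : Fin 3) (x : ℝ × ℝ) :
    Fin 3 → ℝ :=
  ∑ᶠ α : ℤ × ℤ, S.basicLimit (k + 1) ((2 : ℝ) ^ k • x - latticePoint α) •
    S.points d k (net.label l i α)

/-- The rings shrink uniformly to the point `p` : the supremum over the whole `(k+1)`-th ring
domain (all sectors, all cells) of the maximum norm `‖r_{k+1} - p‖_∞` tends to `0`. -/
def RingsTendTo (S : SubdivisionScheme n m) [NeZero n] (net : ControlNet n m)
    (d : Matrix (ZMod n × Fin m) (Fin 3) ℝ) (p : Fin 3 → ℝ) : Prop :=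
  Tendsto (fun k : ℕ =>
    ⨆ (l : ZMod n) (i : Fin 3) (x ∈ net.cell k i), ‖S.ring net d k l i x - p‖ₑ) atTop (𝓝 0)

/-- Convergence in the neighbourhood of the extraordinary element: the scheme converges in regular
regions, its basic limit functions `φ_k` exist at all levels, and for all initial control points
the rings shrink uniformly to a limit point. -/
def ConvergentIrregular (S : SubdivisionScheme n m) [NeZero n] (net : ControlNet n m) : Prop :=
  S.ConvergentRegular ∧
    (∀ k, 1 ≤ k → S.IsLimit k deltaData (S.basicLimit k)) ∧
    ∀ d : Matrix (ZMod n × Fin m) (Fin 3) ℝ, ∃ p : Fin 3 → ℝ, S.RingsTendTo net d p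

end SubdivisionScheme

/-- Absence of ineffective eigenvectors for a stationary scheme: every (complex) eigenvector of
the local matrix for a nonzero eigenvalue generates a first ring which is not identically zero. -/
def NoIneffectiveEigenvectors {n m : ℕ} [NeZero n] (net : ControlNet n m) (c : Mask)
    (B : ZMod n → Matrix (Fin m) (Fin m) ℝ) : Prop :=
  ∀ (μ : ℂ) (v : ZMod n × Fin m → ℂ), μ ≠ 0 → v ≠ 0 →
    (blockCirculant B).map (fun t : ℝ => (t : ℂ)) *ᵥ v = μ • v →
    ∃ (l : ZMod n) (i : Fin 3), ∃ x ∈ net.cell 0 i,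
      ∑ᶠ α : ℤ × ℤ,
        ((stationaryScheme (n := n) (m := m) c B).basicLimit 1 (x - latticePoint α) : ℂ) *
          v (net.label l i α) ≠ 0

/-- The perturbation `y_k = ∑_{j=1}^k S^{k-j} (S_j - S) S^{(j-1)} d_1`. -/
noncomputable def perturbation {n m : ℕ} [NeZero n] (S : SubdivisionScheme n m)
    (A : Matrix (ZMod n × Fin m) (ZMod n × Fin m) ℝ)
    (d : Matrix (ZMod n × Fin m) (Fin 3) ℝ) (k : ℕ) : Matrix (ZMod n × Fin m) (Fin 3) ℝ :=
  ∑ j ∈ Finset.Icc 1 k, A ^ (k - j) * (S.mat j - A) * S.matProd (j - 1) * d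

/-!
# Convergence of non-stationary subdivision near an extraordinary element

Regular regions: the scheme is compared with the stationary scheme of mask `c`, whose basic limit
function is `φ`. Refined data depend linearly and locally on the initial data, so the convergence
of the delta sequence alone gives a uniform rate for all bounded data (`exists_rate`) and uniform
bounds for the powers of `S_c` (`exists_powerBound`). Summability of `‖S_{c^(k)} - S_c‖` then bounds
all products of the operators `S_{c^(k)}` (`exists_refine_bound`), and the stationary limits of the
data of level `k + i` form, after rescaling, a uniform Cauchy sequence in `i`. Its limit is the limit
function, and `φ_k → φ` uniformly (`exists_isLimit`). Since the stationary scheme has a nonzero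
limit function, the translates of `φ` form a partition of unity (`subdiv_one`, `limitOp_one`).

Local matrices: no spectral decomposition of the stationary matrix `A` is needed. The first ring
with control points `A ^ k v` is the `k`-th ring of `v`, rescaled, so its values, which are linear
functionals of `A ^ k v`, converge to a constant `p v`. On the space of vectors with vanishing rings
at all levels `A` is nilpotent, since it has no ineffective eigenvectors; by duality the coordinates
of `A ^ N v` are combinations of ring values for a suitable `N`, and hence `A ^ k v → p v • (1, …, 1)`
(`exists_tendsto_pow`). So the powers of `A` converge to a matrix with equal rows, and this row is
the normalized left eigenvector (`fixedRow_of_tendsto_pow`).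

Perturbation: the control points of level `k + 1` are `A ^ k d` plus the accumulated perturbation
`y_k` (`points_eq_add_perturbation`), which converges by dominated convergence
(`exists_tendsto_perturbation`). All rows of its limit are equal, so all control points tend to one
point, and by the partition of unity so do the rings (`ringsTendTo_of_tendsto_points`).
-/

/-! ### Lattice points in the plane -/

lemma latticePoint_zero : latticePoint 0 = 0 := by
  ext <;> simp [latticePoint]

lemma latticePoint_sub (α β : ℤ × ℤ) :
    latticePoint (α - β) = latticePoint α - latticePoint β := by
  ext <;> simp [latticePoint]

lemma latticePoint_add (α β : ℤ × ℤ) :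
    latticePoint (α + β) = latticePoint α + latticePoint β := by
  ext <;> simp [latticePoint]

lemma latticePoint_nsmul (k : ℕ) (α : ℤ × ℤ) :
    latticePoint (k • α) = (k : ℝ) • latticePoint α := by
  ext <;> simp [latticePoint]

/-- The lattice points at distance at most `R` from `x`, in the maximum norm. -/
noncomputable def nearby (R : ℝ) (x : ℝ × ℝ) : Finset (ℤ × ℤ) :=
  Finset.Icc ⌈x.1 - R⌉ ⌊x.1 + R⌋ ×ˢ Finset.Icc ⌈x.2 - R⌉ ⌊x.2 + R⌋

lemma mem_nearby {R : ℝ} {x : ℝ × ℝ} {β : ℤ × ℤ} :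
    β ∈ nearby R x ↔ ‖x - latticePoint β‖ ≤ R := by
  simp only [nearby, Finset.mem_product, Finset.mem_Icc, Int.ceil_le, Int.le_floor, latticePoint,
    Prod.norm_def, Prod.fst_sub, Prod.snd_sub, sup_le_iff, Real.norm_eq_abs, abs_le]
  constructor
  · rintro ⟨⟨h1, h2⟩, h3, h4⟩
    refine ⟨⟨?_, ?_⟩, ?_, ?_⟩ <;> linarith
  · rintro ⟨⟨h1, h2⟩, h3, h4⟩
    refine ⟨⟨?_, ?_⟩, ?_, ?_⟩ <;> linarith

lemma card_nearby_le {R : ℝ} (hR : 0 ≤ R) (x : ℝ × ℝ) :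
    ((nearby R x).card : ℝ) ≤ (2 * R + 1) ^ 2 := by
  have key : ∀ t : ℝ, (((Finset.Icc ⌈t - R⌉ ⌊t + R⌋).card : ℕ) : ℝ) ≤ 2 * R + 1 := by
    intro t
    rw [Int.card_Icc]
    rcases le_total 0 (⌊t + R⌋ + 1 - ⌈t - R⌉) with h | h
    · have : (((⌊t + R⌋ + 1 - ⌈t - R⌉).toNat : ℤ) : ℝ) = ((⌊t + R⌋ + 1 - ⌈t - R⌉ : ℤ) : ℝ) := by
        rw [Int.toNat_of_nonneg h]
      rw [Int.cast_natCast] at this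
      rw [this]
      push_cast
      have h1 := Int.floor_le (t + R)
      have h2 := Int.le_ceil (t - R)
      linarith
    · rw [Int.toNat_of_nonpos h]
      simp; linarith
  rw [nearby, Finset.card_product, Nat.cast_mul, sq]
  exact mul_le_mul (key _) (key _) (Nat.cast_nonneg _) (by linarith)

/-- The lattice point `⌊2 ^ ℓ x⌋`. -/
noncomputable def dyadicFloor (x : ℝ × ℝ) (ℓ : ℕ) : ℤ × ℤ :=
  (⌊(2 : ℝ) ^ ℓ * x.1⌋, ⌊(2 : ℝ) ^ ℓ * x.2⌋)

lemma tendsto_dyadicFloor (x : ℝ × ℝ) :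
    Tendsto (fun ℓ : ℕ => ((2 : ℝ) ^ ℓ)⁻¹ • latticePoint (dyadicFloor x ℓ)) atTop (𝓝 x) := by
  have key : ∀ t : ℝ, Tendsto (fun ℓ : ℕ => ((2 : ℝ) ^ ℓ)⁻¹ * (⌊(2 : ℝ) ^ ℓ * t⌋ : ℝ))
      atTop (𝓝 t) := by
    intro t
    have h0 : Tendsto (fun ℓ : ℕ => ((2 : ℝ) ^ ℓ)⁻¹) atTop (𝓝 0) :=
      (tendsto_pow_atTop_atTop_of_one_lt (by norm_num : (1 : ℝ) < 2)).inv_tendsto_atTop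
    have h1 : Tendsto (fun ℓ : ℕ => t - ((2 : ℝ) ^ ℓ)⁻¹) atTop (𝓝 t) := by
      simpa using tendsto_const_nhds.sub h0
    refine tendsto_of_tendsto_of_tendsto_of_le_of_le h1 tendsto_const_nhds ?_ ?_
    · intro ℓ
      have hp : (0 : ℝ) < 2 ^ ℓ := by positivity
      have := Int.sub_one_lt_floor ((2 : ℝ) ^ ℓ * t)
      calc t - ((2 : ℝ) ^ ℓ)⁻¹ = ((2 : ℝ) ^ ℓ)⁻¹ * ((2 : ℝ) ^ ℓ * t - 1) := by field_simp
        _ ≤ _ := mul_le_mul_of_nonneg_left this.le (by positivity)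
    · intro ℓ
      have hp : (0 : ℝ) < 2 ^ ℓ := by positivity
      have := Int.floor_le ((2 : ℝ) ^ ℓ * t)
      calc ((2 : ℝ) ^ ℓ)⁻¹ * (⌊(2 : ℝ) ^ ℓ * t⌋ : ℝ) ≤ ((2 : ℝ) ^ ℓ)⁻¹ * ((2 : ℝ) ^ ℓ * t) := by
            gcongr
        _ = t := by field_simp
  exact (key x.1).prodMk_nhds (key x.2)

/-! ### The subdivision operator -/

namespace Mask

/-- The support of the mask lies in the ball of radius `R` in the maximum norm. -/
def SupportedIn (c : Mask) (R : ℝ) : Prop := ∀ γ, c γ ≠ 0 → ‖latticePoint γ‖ ≤ R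

lemma finite_setOf_ne_zero (c : Mask) (α : ℤ × ℤ) : {β : ℤ × ℤ | c (α - 2 • β) ≠ 0}.Finite := by
  have hinj : Function.Injective fun β : ℤ × ℤ => α - 2 • β := by
    intro β γ h
    simp only [sub_right_inj] at h
    ext
    · simpa using congrArg Prod.fst h
    · simpa using congrArg Prod.snd h
  exact (c.support.finite_toSet.preimage hinj.injOn).subset fun β hβ => by simpa using hβ

lemma finite_support_mul (c : Mask) (α : ℤ × ℤ) (f : ℤ × ℤ → ℝ) :
    (Function.support fun β => c (α - 2 • β) * f β).Finite :=
  (c.finite_setOf_ne_zero α).subset fun _ hβ => left_ne_zero_of_mul hβ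

/-- The subdivision operator as a linear map. -/
noncomputable def subdivLin (c : Mask) : (ℤ × ℤ → ℝ) →ₗ[ℝ] (ℤ × ℤ → ℝ) where
  toFun := c.subdiv
  map_add' f g := by
    ext α
    simp only [subdiv, Pi.add_apply, mul_add]
    exact finsum_add_distrib (c.finite_support_mul α f) (c.finite_support_mul α g)
  map_smul' r f := by
    ext α
    simp only [subdiv, Pi.smul_apply, smul_eq_mul, RingHom.id_apply]
    refine (finsum_congr fun β => ?_).trans
      (smul_finsum' r (c.finite_support_mul α f)).symm
    simp only [smul_eq_mul]; ring

lemma subdivLin_apply (c : Mask) (f : ℤ × ℤ → ℝ) : c.subdivLin f = c.subdiv f := rfl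

lemma sub_subdiv (c c' : Mask) (f : ℤ × ℤ → ℝ) :
    (c - c').subdiv f = c.subdiv f - c'.subdiv f := by
  ext α
  simp only [subdiv, Pi.sub_apply, Finsupp.coe_sub, sub_mul]
  exact finsum_sub_distrib (c.finite_support_mul α f) (c'.finite_support_mul α f)

lemma subdiv_translate (c : Mask) (f : ℤ × ℤ → ℝ) (β α : ℤ × ℤ) :
    c.subdiv (fun γ => f (γ - β)) α = c.subdiv f (α - 2 • β) := by
  unfold subdiv
  rw [← finsum_comp_equiv (Equiv.addRight β)]
  refine finsum_congr fun γ => ?_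
  simp only [Equiv.coe_addRight, add_sub_cancel_right]
  congr 2
  rw [smul_add]; abel

lemma finsum_abs_le_opNorm (c : Mask) (α : ℤ × ℤ) :
    ∑ᶠ β : ℤ × ℤ, |c (α - 2 • β)| ≤ c.opNorm := by
  set e : Fin 2 × Fin 2 := (⟨(α.1 % 2).toNat, by omega⟩, ⟨(α.2 % 2).toNat, by omega⟩) with he
  have hα : α = ((((e.1 : ℕ) : ℤ), ((e.2 : ℕ) : ℤ)) : ℤ × ℤ) + 2 • (α.1 / 2, α.2 / 2) := by
    ext <;> simp [he] <;> omega
  have h : ∑ᶠ β : ℤ × ℤ, |c (α - 2 • β)|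
      = ∑ᶠ β : ℤ × ℤ, |c ((((e.1 : ℕ) : ℤ), ((e.2 : ℕ) : ℤ)) - 2 • β)| := by
    rw [← finsum_comp_equiv (Equiv.addRight ((α.1 / 2, α.2 / 2) : ℤ × ℤ))]
    refine finsum_congr fun γ => ?_
    simp only [Equiv.coe_addRight]
    congr 2
    nth_rw 1 [hα]
    rw [smul_add]; abel
  rw [h]
  exact le_ciSup (f := fun e : Fin 2 × Fin 2 =>
    ∑ᶠ β : ℤ × ℤ, |c ((((e.1 : ℕ) : ℤ), ((e.2 : ℕ) : ℤ)) - 2 • β)|) (Set.finite_range _).bddAbove e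

lemma opNorm_nonneg (c : Mask) : 0 ≤ c.opNorm :=
  (finsum_nonneg fun _ => abs_nonneg _).trans (c.finsum_abs_le_opNorm 0)

lemma abs_subdiv_le (c : Mask) {f : ℤ × ℤ → ℝ} {M : ℝ} (hf : ∀ α, |f α| ≤ M) (α : ℤ × ℤ) :
    |c.subdiv f α| ≤ c.opNorm * M := by
  have hM : 0 ≤ M := (abs_nonneg _).trans (hf 0)
  have hfin := c.finite_setOf_ne_zero α
  have h1 : c.subdiv f α = ∑ β ∈ hfin.toFinset, c (α - 2 • β) * f β :=
    finsum_eq_sum_of_support_subset _ fun β hβ => by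
      simpa using left_ne_zero_of_mul hβ
  have h2 : ∑ᶠ β : ℤ × ℤ, |c (α - 2 • β)| = ∑ β ∈ hfin.toFinset, |c (α - 2 • β)| :=
    finsum_eq_sum_of_support_subset _ fun β hβ => by simpa using hβ
  calc |c.subdiv f α| ≤ ∑ β ∈ hfin.toFinset, |c (α - 2 • β) * f β| := by
        rw [h1]; exact Finset.abs_sum_le_sum_abs _ _
    _ ≤ ∑ β ∈ hfin.toFinset, |c (α - 2 • β)| * M := by
        refine Finset.sum_le_sum fun β _ => ?_
        rw [abs_mul]
        exact mul_le_mul_of_nonneg_left (hf β) (abs_nonneg _)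
    _ = (∑ᶠ β : ℤ × ℤ, |c (α - 2 • β)|) * M := by rw [h2, Finset.sum_mul]
    _ ≤ c.opNorm * M := mul_le_mul_of_nonneg_right (c.finsum_abs_le_opNorm α) hM

lemma subdiv_eq_zero {c : Mask} {R : ℝ} (hc : c.SupportedIn R) {f : ℤ × ℤ → ℝ} {α : ℤ × ℤ}
    (hf : ∀ β, ‖latticePoint α - (2 : ℝ) • latticePoint β‖ ≤ R → f β = 0) :
    c.subdiv f α = 0 := by
  refine finsum_eq_zero_of_forall_eq_zero fun β => ?_
  by_cases h : c (α - 2 • β) = 0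
  · rw [h, zero_mul]
  · have := hc _ h
    rw [latticePoint_sub, latticePoint_nsmul] at this
    rw [hf β (by simpa using this), mul_zero]

lemma exists_supportedIn (A : Finset (ℤ × ℤ)) :
    ∃ R : ℝ, 0 ≤ R ∧ ∀ c : Mask, c.support ⊆ A → c.SupportedIn R := by
  refine ⟨∑ γ ∈ A, ‖latticePoint γ‖, Finset.sum_nonneg fun _ _ => norm_nonneg _, ?_⟩
  intro c hc γ hγ
  exact Finset.single_le_sum (f := fun γ => ‖latticePoint γ‖) (fun _ _ => norm_nonneg _)
    (hc (Finsupp.mem_support_iff.2 hγ))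

end Mask

/-! ### Refinement of data on the regular lattice -/

namespace SubdivisionScheme

variable {n m : ℕ}

/-- Refinement over `ℓ` levels as a linear map. -/
noncomputable def refineLin (S : SubdivisionScheme n m) (k : ℕ) :
    ℕ → (ℤ × ℤ → ℝ) →ₗ[ℝ] (ℤ × ℤ → ℝ)
  | 0 => LinearMap.id
  | ℓ + 1 => (S.mask (k + ℓ)).subdivLin ∘ₗ S.refineLin k ℓ

lemma refineLin_apply (S : SubdivisionScheme n m) (k ℓ : ℕ) (f : ℤ × ℤ → ℝ) :
    S.refineLin k ℓ f = S.refine k f ℓ := by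
  induction ℓ with
  | zero => rfl
  | succ ℓ ih => simp [refineLin, refine, ih, Mask.subdivLin_apply]

lemma refine_sub (S : SubdivisionScheme n m) (k ℓ : ℕ) (f g : ℤ × ℤ → ℝ) :
    S.refine k (f - g) ℓ = S.refine k f ℓ - S.refine k g ℓ := by
  simp only [← refineLin_apply, map_sub]

lemma refine_translate (S : SubdivisionScheme n m) (k ℓ : ℕ) (f : ℤ × ℤ → ℝ) (β α : ℤ × ℤ) :
    S.refine k (fun γ => f (γ - β)) ℓ α = S.refine k f ℓ (α - 2 ^ ℓ • β) := by
  induction ℓ generalizing α with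
  | zero => simp [refine]
  | succ ℓ ih =>
    have : S.refine k (fun γ => f (γ - β)) ℓ = fun γ => S.refine k f ℓ (γ - 2 ^ ℓ • β) :=
      funext ih
    rw [refine, this, Mask.subdiv_translate, refine, smul_smul, pow_succ']

/-- Locality of refinement: the value at `α` after `ℓ` levels only depends on the data at the
lattice points at distance at most `R` from `2 ^ (-ℓ) α`. -/
lemma refine_eq_zero {S : SubdivisionScheme n m} {k : ℕ} {R : ℝ} (hR : 0 ≤ R)
    (hS : ∀ j, k ≤ j → (S.mask j).SupportedIn R) {f : ℤ × ℤ → ℝ} {ℓ : ℕ} {α : ℤ × ℤ}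
    (hf : ∀ β ∈ nearby R (((2 : ℝ) ^ ℓ)⁻¹ • latticePoint α), f β = 0) :
    S.refine k f ℓ α = 0 := by
  -- the induction runs with the sharper radius `(1 - 2 ^ (-ℓ)) R`
  suffices h : ∀ (ℓ : ℕ) (α : ℤ × ℤ), (∀ β, ‖((2 : ℝ) ^ ℓ)⁻¹ • latticePoint α - latticePoint β‖ ≤
      (1 - ((2 : ℝ) ^ ℓ)⁻¹) * R → f β = 0) → S.refine k f ℓ α = 0 by
    refine h ℓ α fun β hβ => hf β (mem_nearby.2 (hβ.trans ?_))
    have : 0 ≤ ((2 : ℝ) ^ ℓ)⁻¹ := by positivity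
    nlinarith
  clear hf ℓ α
  intro ℓ
  induction ℓ with
  | zero => intro α h; exact h α (by simp)
  | succ ℓ ih =>
    intro α h
    refine Mask.subdiv_eq_zero (hS _ (Nat.le_add_right _ _)) fun γ hγ => ih γ fun β hβ => h β ?_
    have hp : (0 : ℝ) < 2 ^ ℓ := by positivity
    have e : ((2 : ℝ) ^ (ℓ + 1))⁻¹ • latticePoint α - latticePoint β =
        ((2 : ℝ) ^ (ℓ + 1))⁻¹ • (latticePoint α - (2 : ℝ) • latticePoint γ) +
          (((2 : ℝ) ^ ℓ)⁻¹ • latticePoint γ - latticePoint β) := by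
      rw [smul_sub, smul_smul]
      have : ((2 : ℝ) ^ (ℓ + 1))⁻¹ * 2 = ((2 : ℝ) ^ ℓ)⁻¹ := by rw [pow_succ]; field_simp
      rw [this]; abel
    rw [e]
    refine (norm_add_le _ _).trans ?_
    rw [norm_smul, Real.norm_of_nonneg (by positivity)]
    calc _ ≤ ((2 : ℝ) ^ (ℓ + 1))⁻¹ * R + (1 - ((2 : ℝ) ^ ℓ)⁻¹) * R := by gcongr
      _ = (1 - ((2 : ℝ) ^ (ℓ + 1))⁻¹) * R := by rw [pow_succ]; field_simp; ring

lemma refine_deltaData_eq_zero {S : SubdivisionScheme n m} {k : ℕ} {R : ℝ} (hR : 0 ≤ R)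
    (hS : ∀ j, k ≤ j → (S.mask j).SupportedIn R) {ℓ : ℕ} {α : ℤ × ℤ}
    (hα : R < ‖((2 : ℝ) ^ ℓ)⁻¹ • latticePoint α‖) : S.refine k deltaData ℓ α = 0 := by
  refine refine_eq_zero hR hS fun β hβ => ?_
  rw [deltaData, if_neg]
  rintro rfl
  rw [mem_nearby, latticePoint_zero, sub_zero] at hβ
  exact hβ.not_gt hα

/-- Refined data as a combination of the translates of the refined delta sequence. -/
lemma refine_eq_sum {S : SubdivisionScheme n m} {k : ℕ} {R : ℝ} (hR : 0 ≤ R)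
    (hS : ∀ j, k ≤ j → (S.mask j).SupportedIn R) (f : ℤ × ℤ → ℝ) (ℓ : ℕ) (α : ℤ × ℤ) :
    S.refine k f ℓ α = ∑ β ∈ nearby R (((2 : ℝ) ^ ℓ)⁻¹ • latticePoint α),
      f β * S.refine k deltaData ℓ (α - 2 ^ ℓ • β) := by
  set F := nearby R (((2 : ℝ) ^ ℓ)⁻¹ • latticePoint α) with hF
  have h : S.refine k (f - ∑ β ∈ F, f β • fun γ => deltaData (γ - β)) ℓ α = 0 := by
    refine refine_eq_zero hR hS fun β hβ => ?_
    simp only [Pi.sub_apply, Finset.sum_apply, Pi.smul_apply, deltaData, sub_eq_zero, smul_eq_mul,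
      mul_ite, mul_one, mul_zero]
    rw [Finset.sum_ite_eq, if_pos hβ]
  rw [refine_sub, Pi.sub_apply, sub_eq_zero] at h
  rw [h, ← refineLin_apply, map_sum, Finset.sum_apply]
  refine Finset.sum_congr rfl fun β _ => ?_
  rw [map_smul, Pi.smul_apply, refineLin_apply, refine_translate, smul_eq_mul]

/-! ### Limit functions -/

/-- The value `g x` of the limit function is the limit of the refined data at lattice points `a ℓ`
with `2 ^ (-ℓ) a ℓ → x`. -/
lemma IsLimit.tendsto {S : SubdivisionScheme n m} {k : ℕ} {f : ℤ × ℤ → ℝ} {g : ℝ × ℝ → ℝ}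
    (h : S.IsLimit k f g) {x : ℝ × ℝ} {a : ℕ → ℤ × ℤ}
    (ha : Tendsto (fun ℓ : ℕ => ((2 : ℝ) ^ ℓ)⁻¹ • latticePoint (a ℓ)) atTop (𝓝 x)) :
    Tendsto (fun ℓ => S.refine k f ℓ (a ℓ)) atTop (𝓝 (g x)) := by
  have h1 := (h.1.tendsto x).comp ha
  have h2 : Tendsto (fun ℓ => g (((2 : ℝ) ^ ℓ)⁻¹ • latticePoint (a ℓ)) - S.refine k f ℓ (a ℓ))
      atTop (𝓝 0) := by
    rw [tendsto_zero_iff_enorm_tendsto_zero]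
    exact tendsto_of_tendsto_of_tendsto_of_le_of_le tendsto_const_nhds h.2 (fun _ => zero_le)
      fun ℓ => le_iSup (fun α => ‖g (((2 : ℝ) ^ ℓ)⁻¹ • latticePoint α) - S.refine k f ℓ α‖ₑ) (a ℓ)
  simpa using h1.sub h2

lemma IsLimit.unique {S : SubdivisionScheme n m} {k : ℕ} {f : ℤ × ℤ → ℝ} {g g' : ℝ × ℝ → ℝ}
    (h : S.IsLimit k f g) (h' : S.IsLimit k f g') : g = g' :=
  funext fun x => tendsto_nhds_unique (h.tendsto (tendsto_dyadicFloor x))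
    (h'.tendsto (tendsto_dyadicFloor x))

lemma isLimit_of_eventually_le {S : SubdivisionScheme n m} {k : ℕ} {f : ℤ × ℤ → ℝ} {g : ℝ × ℝ → ℝ}
    (hg : Continuous g) {u : ℕ → ℝ} (hu : Tendsto u atTop (𝓝 0))
    (h : ∀ᶠ ℓ in atTop, ∀ α,
      |g (((2 : ℝ) ^ ℓ)⁻¹ • latticePoint α) - S.refine k f ℓ α| ≤ u ℓ) :
    S.IsLimit k f g := by
  refine ⟨hg, ?_⟩
  have hu' : Tendsto (fun ℓ => ENNReal.ofReal (u ℓ)) atTop (𝓝 0) := by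
    simpa using ENNReal.tendsto_ofReal hu
  refine tendsto_of_tendsto_of_tendsto_of_le_of_le' tendsto_const_nhds hu'
    (.of_forall fun _ => zero_le) (h.mono fun ℓ hℓ => iSup_le fun α => ?_)
  rw [Real.enorm_eq_ofReal_abs]
  exact ENNReal.ofReal_le_ofReal (hℓ α)

/-- The distance of the refined data from a limit function, as a real null sequence. -/
lemma IsLimit.exists_bound {S : SubdivisionScheme n m} {k : ℕ} {f : ℤ × ℤ → ℝ} {g : ℝ × ℝ → ℝ}
    (h : S.IsLimit k f g) : ∃ u : ℕ → ℝ, Tendsto u atTop (𝓝 0) ∧ ∀ᶠ ℓ in atTop, ∀ α,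
      |g (((2 : ℝ) ^ ℓ)⁻¹ • latticePoint α) - S.refine k f ℓ α| ≤ u ℓ := by
  refine ⟨fun ℓ => (⨆ α : ℤ × ℤ,
    ‖g (((2 : ℝ) ^ ℓ)⁻¹ • latticePoint α) - S.refine k f ℓ α‖ₑ).toReal, ?_, ?_⟩
  · exact (ENNReal.tendsto_toReal ENNReal.zero_ne_top).comp h.2
  · filter_upwards [h.2.eventually (gt_mem_nhds (ENNReal.zero_lt_top))] with ℓ hℓ α
    have := le_iSup (fun α => ‖g (((2 : ℝ) ^ ℓ)⁻¹ • latticePoint α) - S.refine k f ℓ α‖ₑ) α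
    rw [← Real.norm_eq_abs, ← toReal_enorm]
    exact ENNReal.toReal_mono hℓ.ne this

lemma IsLimit.eq_zero_of_norm_gt {S : SubdivisionScheme n m} {k : ℕ} {R : ℝ} (hR : 0 ≤ R)
    (hS : ∀ j, k ≤ j → (S.mask j).SupportedIn R) {g : ℝ × ℝ → ℝ} (h : S.IsLimit k deltaData g)
    {x : ℝ × ℝ} (hx : R < ‖x‖) : g x = 0 := by
  refine tendsto_nhds_unique (h.tendsto (tendsto_dyadicFloor x))
    (tendsto_const_nhds.congr' ?_)
  filter_upwards [(tendsto_dyadicFloor x).norm.eventually (lt_mem_nhds hx)] with ℓ hℓ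
  exact (refine_deltaData_eq_zero hR hS hℓ).symm

lemma isLimit_basicLimit {S : SubdivisionScheme n m} {k : ℕ} (h : ∃ g, S.IsLimit k deltaData g) :
    S.IsLimit k deltaData (S.basicLimit k) := by
  rw [basicLimit, dif_pos h]
  exact h.choose_spec

end SubdivisionScheme

/-! ### Limit functions of stationary schemes -/

/-- The function `∑_β f_β φ(x - β)`, which is the limit function of the data `f` when `φ` is the
basic limit function of a stationary scheme. -/
noncomputable def limitOp (φ : ℝ × ℝ → ℝ) (f : ℤ × ℤ → ℝ) (x : ℝ × ℝ) : ℝ :=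
  ∑ᶠ β : ℤ × ℤ, φ (x - latticePoint β) * f β

section limitOp

variable {φ : ℝ × ℝ → ℝ} {R : ℝ}

lemma support_translates_subset (hφ : ∀ x, R < ‖x‖ → φ x = 0) (x : ℝ × ℝ) :
    (Function.support fun β : ℤ × ℤ => φ (x - latticePoint β)) ⊆ nearby R x := by
  intro β hβ
  rw [Finset.mem_coe, mem_nearby]
  by_contra h
  exact hβ (hφ _ (not_le.1 h))

lemma limitOp_eq_sum (hφ : ∀ x, R < ‖x‖ → φ x = 0) (f : ℤ × ℤ → ℝ) {x : ℝ × ℝ}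
    {F : Finset (ℤ × ℤ)} (hF : nearby R x ⊆ F) :
    limitOp φ f x = ∑ β ∈ F, φ (x - latticePoint β) * f β :=
  finsum_eq_sum_of_support_subset _ fun _ hβ =>
    hF (support_translates_subset hφ x (left_ne_zero_of_mul hβ))

lemma limitOp_sub (hφ : ∀ x, R < ‖x‖ → φ x = 0) (f g : ℤ × ℤ → ℝ) (x : ℝ × ℝ) :
    limitOp φ (f - g) x = limitOp φ f x - limitOp φ g x := by
  simp only [limitOp_eq_sum hφ _ (Finset.Subset.refl (nearby R x)), Pi.sub_apply, mul_sub,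
    Finset.sum_sub_distrib]

lemma limitOp_deltaData : limitOp φ deltaData = φ := by
  ext x
  rw [limitOp, finsum_eq_single _ (0 : ℤ × ℤ)]
  · simp [deltaData, latticePoint_zero]
  · intro β hβ
    simp [deltaData, hβ]

lemma continuous_limitOp (hφ : ∀ x, R < ‖x‖ → φ x = 0) (hc : Continuous φ) (f : ℤ × ℤ → ℝ) :
    Continuous (limitOp φ f) := by
  rw [continuous_iff_continuousAt]
  intro x₀
  have h : (fun x => ∑ β ∈ nearby (R + 1) x₀, φ (x - latticePoint β) * f β) =ᶠ[𝓝 x₀]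
      limitOp φ f := by
    filter_upwards [Metric.ball_mem_nhds x₀ one_pos] with x hx
    refine (limitOp_eq_sum hφ f fun β hβ => ?_).symm
    rw [mem_nearby] at hβ ⊢
    rw [mem_ball_iff_norm'] at hx
    calc ‖x₀ - latticePoint β‖ = ‖(x - latticePoint β) + (x₀ - x)‖ := by congr 1; abel
      _ ≤ R + 1 := (norm_add_le _ _).trans (add_le_add hβ hx.le)
  refine ContinuousAt.congr ?_ h
  fun_prop

lemma abs_limitOp_le (hR : 0 ≤ R) (hφ : ∀ x, R < ‖x‖ → φ x = 0) {Φ : ℝ} (hΦ : ∀ x, |φ x| ≤ Φ)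
    {f : ℤ × ℤ → ℝ} {M : ℝ} (hf : ∀ β, |f β| ≤ M) (x : ℝ × ℝ) :
    |limitOp φ f x| ≤ (2 * R + 1) ^ 2 * Φ * M := by
  have hΦ0 : 0 ≤ Φ := (abs_nonneg _).trans (hΦ 0)
  have hM : 0 ≤ M := (abs_nonneg _).trans (hf 0)
  rw [limitOp_eq_sum hφ f (Finset.Subset.refl _)]
  calc _ ≤ ∑ β ∈ nearby R x, |φ (x - latticePoint β) * f β| := Finset.abs_sum_le_sum_abs _ _
    _ ≤ ∑ β ∈ nearby R x, Φ * M := Finset.sum_le_sum fun β _ => by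
        rw [abs_mul]; exact mul_le_mul (hΦ _) (hf β) (abs_nonneg _) hΦ0
    _ = (nearby R x).card * (Φ * M) := by rw [Finset.sum_const, nsmul_eq_mul]
    _ ≤ (2 * R + 1) ^ 2 * (Φ * M) :=
        mul_le_mul_of_nonneg_right (card_nearby_le hR x) (mul_nonneg hΦ0 hM)
    _ = _ := by ring

lemma exists_bound_of_compactSupport (hφ : ∀ x, R < ‖x‖ → φ x = 0) (hc : Continuous φ) :
    ∃ Φ, 0 ≤ Φ ∧ ∀ x, |φ x| ≤ Φ := by
  obtain ⟨Φ, hΦ⟩ := (isCompact_closedBall (0 : ℝ × ℝ) R).exists_bound_of_continuousOn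
    hc.continuousOn
  refine ⟨max Φ 0, le_max_right _ _, fun x => ?_⟩
  by_cases hx : ‖x‖ ≤ R
  · exact (hΦ x (by simpa using hx)).trans (le_max_left _ _)
  · rw [hφ x (not_le.1 hx), abs_zero]; exact le_max_right _ _

end limitOp

section stationary

variable {n m : ℕ} {c : Mask} {B : ZMod n → Matrix (Fin m) (Fin m) ℝ} {R : ℝ} {φ : ℝ × ℝ → ℝ}

lemma refine_stationaryScheme (c : Mask) (B : ZMod n → Matrix (Fin m) (Fin m) ℝ) (k : ℕ)
    (f : ℤ × ℤ → ℝ) (ℓ : ℕ) : (stationaryScheme c B).refine k f ℓ = c.subdiv^[ℓ] f := by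
  induction ℓ with
  | zero => rfl
  | succ ℓ ih => rw [Function.iterate_succ_apply', ← ih]; rfl

lemma iterate_subdiv_sub (c : Mask) (f g : ℤ × ℤ → ℝ) (ℓ : ℕ) :
    c.subdiv^[ℓ] (f - g) = c.subdiv^[ℓ] f - c.subdiv^[ℓ] g :=
  iterate_map_sub c.subdivLin ℓ f g

lemma abs_iterate_subdiv_le (c : Mask) {f : ℤ × ℤ → ℝ} {M : ℝ} (hf : ∀ α, |f α| ≤ M) (ℓ : ℕ)
    (α : ℤ × ℤ) : |c.subdiv^[ℓ] f α| ≤ c.opNorm ^ ℓ * M := by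
  induction ℓ generalizing α with
  | zero => simpa using hf α
  | succ ℓ ih =>
    rw [Function.iterate_succ_apply', pow_succ', mul_assoc]
    exact c.abs_subdiv_le ih α

/-- For a stationary scheme with basic limit function `φ`, refined data approach `∑ f_β φ(· - β)`
at a rate that only depends on the bound of the data: at every point boundedly many translates
of the refined delta sequence contribute. -/
lemma exists_rate (hR : 0 ≤ R) (hc : c.SupportedIn R)
    (h : (stationaryScheme c B).IsLimit 1 deltaData φ) :
    ∃ η : ℕ → ℝ, Tendsto η atTop (𝓝 0) ∧ ∀ᶠ ℓ in atTop, ∀ (f : ℤ × ℤ → ℝ) (M : ℝ),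
      (∀ α, |f α| ≤ M) → ∀ α,
        |limitOp φ f (((2 : ℝ) ^ ℓ)⁻¹ • latticePoint α) - c.subdiv^[ℓ] f α| ≤ η ℓ * M := by
  have hφ : ∀ x, R < ‖x‖ → φ x = 0 := fun x hx => h.eq_zero_of_norm_gt hR (fun _ _ => hc) hx
  obtain ⟨u, hu, hle⟩ := h.exists_bound
  refine ⟨fun ℓ => (2 * R + 1) ^ 2 * u ℓ, by simpa using hu.const_mul ((2 * R + 1) ^ 2),
    hle.mono fun ℓ hℓ f M hf α => ?_⟩
  have hM : 0 ≤ M := (abs_nonneg _).trans (hf 0)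
  have hu0 : 0 ≤ u ℓ := (abs_nonneg _).trans (hℓ 0)
  set x := ((2 : ℝ) ^ ℓ)⁻¹ • latticePoint α with hx
  have e := (stationaryScheme c B).refine_eq_sum (k := 1) hR (fun _ _ => hc) f ℓ α
  rw [refine_stationaryScheme, ← hx] at e
  rw [limitOp_eq_sum hφ f (Finset.Subset.refl _), e, ← Finset.sum_sub_distrib]
  calc _ ≤ ∑ β ∈ nearby R x, |φ (x - latticePoint β) * f β -
          f β * (stationaryScheme c B).refine 1 deltaData ℓ (α - 2 ^ ℓ • β)| :=
        Finset.abs_sum_le_sum_abs _ _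
    _ ≤ ∑ β ∈ nearby R x, u ℓ * M := Finset.sum_le_sum fun β _ => by
        have e2 : x - latticePoint β = ((2 : ℝ) ^ ℓ)⁻¹ • latticePoint (α - 2 ^ ℓ • β) := by
          rw [latticePoint_sub, latticePoint_nsmul, smul_sub, smul_smul, hx]
          push_cast
          rw [inv_mul_cancel₀ (by positivity), one_smul]
        rw [mul_comm (f β), ← sub_mul, abs_mul, e2]
        exact mul_le_mul (hℓ _) (hf β) (abs_nonneg _) hu0
    _ = (nearby R x).card * (u ℓ * M) := by rw [Finset.sum_const, nsmul_eq_mul]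
    _ ≤ (2 * R + 1) ^ 2 * (u ℓ * M) :=
        mul_le_mul_of_nonneg_right (card_nearby_le hR x) (mul_nonneg hu0 hM)
    _ = _ := by ring

/-- The powers of a convergent stationary subdivision operator are uniformly bounded. -/
lemma exists_powerBound (hR : 0 ≤ R) (hc : c.SupportedIn R)
    (h : (stationaryScheme c B).IsLimit 1 deltaData φ) :
    ∃ K : ℝ, 0 ≤ K ∧ ∀ (f : ℤ × ℤ → ℝ) (M : ℝ), (∀ α, |f α| ≤ M) →
      (∀ ℓ α, |c.subdiv^[ℓ] f α| ≤ K * M) ∧ ∀ x, |limitOp φ f x| ≤ K * M := by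
  have hφ : ∀ x, R < ‖x‖ → φ x = 0 := fun x hx => h.eq_zero_of_norm_gt hR (fun _ _ => hc) hx
  obtain ⟨Φ, hΦ0, hΦ⟩ := exists_bound_of_compactSupport hφ h.1
  obtain ⟨η, hη, hle⟩ := exists_rate hR hc h
  obtain ⟨ℓ₀, hℓ₀⟩ := eventually_atTop.1 (hle.and (hη.eventually (gt_mem_nhds one_pos)))
  have hs : 0 ≤ ∑ i ∈ Finset.range ℓ₀, c.opNorm ^ i :=
    Finset.sum_nonneg fun i _ => pow_nonneg c.opNorm_nonneg i
  have hN : 0 ≤ (2 * R + 1) ^ 2 * Φ := by positivity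
  refine ⟨(2 * R + 1) ^ 2 * Φ + 1 + ∑ i ∈ Finset.range ℓ₀, c.opNorm ^ i, by positivity,
    fun f M hf => ⟨fun ℓ α => ?_, fun x => ?_⟩⟩
  · have hM : 0 ≤ M := (abs_nonneg _).trans (hf 0)
    rcases lt_or_ge ℓ ℓ₀ with hℓ | hℓ
    · refine (abs_iterate_subdiv_le c hf ℓ α).trans (mul_le_mul_of_nonneg_right ?_ hM)
      have := Finset.single_le_sum (f := fun i => c.opNorm ^ i)
        (fun i _ => pow_nonneg c.opNorm_nonneg i) (Finset.mem_range.2 hℓ)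
      linarith
    · have h1 := (hℓ₀ ℓ hℓ).1 f M hf α
      have h2 := mul_le_mul_of_nonneg_right (hℓ₀ ℓ hℓ).2.le hM
      have h3 := abs_limitOp_le hR hφ hΦ hf (((2 : ℝ) ^ ℓ)⁻¹ • latticePoint α)
      have h4 := abs_sub_abs_le_abs_sub (c.subdiv^[ℓ] f α)
        (limitOp φ f (((2 : ℝ) ^ ℓ)⁻¹ • latticePoint α))
      rw [abs_sub_comm] at h4
      nlinarith [mul_nonneg hs hM]
  · have hM : 0 ≤ M := (abs_nonneg _).trans (hf 0)
    have := abs_limitOp_le hR hφ hΦ hf x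
    nlinarith [mul_nonneg hs hM]

lemma isLimit_limitOp (hR : 0 ≤ R) (hc : c.SupportedIn R)
    (h : (stationaryScheme c B).IsLimit 1 deltaData φ) {f : ℤ × ℤ → ℝ} (hf : BoundedData f) :
    (stationaryScheme c B).IsLimit 1 f (limitOp φ f) := by
  have hφ : ∀ x, R < ‖x‖ → φ x = 0 := fun x hx => h.eq_zero_of_norm_gt hR (fun _ _ => hc) hx
  obtain ⟨M, hM⟩ := hf
  obtain ⟨η, hη, hle⟩ := exists_rate hR hc h
  refine SubdivisionScheme.isLimit_of_eventually_le (continuous_limitOp hφ h.1 f)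
    (by simpa using hη.mul_const M) (hle.mono fun ℓ hℓ α => ?_)
  rw [refine_stationaryScheme]
  exact hℓ f M hM α

lemma BoundedData.subdiv {f : ℤ × ℤ → ℝ} (hf : BoundedData f) (c : Mask) :
    BoundedData (c.subdiv f) :=
  hf.imp' _ fun _ hM => c.abs_subdiv_le hM

/-- The refinement equation. -/
lemma limitOp_subdiv (hR : 0 ≤ R) (hc : c.SupportedIn R)
    (h : (stationaryScheme c B).IsLimit 1 deltaData φ) {f : ℤ × ℤ → ℝ} (hf : BoundedData f)
    (x : ℝ × ℝ) : limitOp φ (c.subdiv f) ((2 : ℝ) • x) = limitOp φ f x := by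
  have h1 := (isLimit_limitOp hR hc h (hf.subdiv c)).tendsto (tendsto_dyadicFloor ((2 : ℝ) • x))
  have h2 := ((isLimit_limitOp hR hc h hf).tendsto (tendsto_dyadicFloor x)).comp
    (tendsto_add_atTop_nat 1)
  refine tendsto_nhds_unique h1 (h2.congr fun ℓ => ?_)
  simp only [Function.comp_apply, refine_stationaryScheme, Function.iterate_succ_apply,
    dyadicFloor, pow_succ, Prod.smul_fst, Prod.smul_snd, smul_eq_mul, mul_assoc]

/-- The coefficients of a stationary mask over each coset of `2ℤ²` sum to one as soon as the
scheme has a nonzero limit function: at a point where the limit is nonzero, all nearby data of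
both levels `ℓ` and `ℓ + 1` tend to the same nonzero value. -/
lemma subdiv_one {f : ℤ × ℤ → ℝ} {g : ℝ × ℝ → ℝ} (h : (stationaryScheme c B).IsLimit 1 f g)
    (hg : g ≠ 0) : c.subdiv 1 = 1 := by
  obtain ⟨x, hx⟩ := Function.ne_iff.1 hg
  ext e
  have h0 : Tendsto (fun ℓ : ℕ => ((2 : ℝ) ^ ℓ)⁻¹) atTop (𝓝 0) :=
    (tendsto_pow_atTop_atTop_of_one_lt (by norm_num : (1 : ℝ) < 2)).inv_tendsto_atTop
  have hshift : ∀ β : ℤ × ℤ, Tendsto (fun ℓ : ℕ =>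
      ((2 : ℝ) ^ ℓ)⁻¹ • latticePoint (dyadicFloor x ℓ + β)) atTop (𝓝 x) := by
    intro β
    have := (tendsto_dyadicFloor x).add (h0.smul_const (latticePoint β))
    simpa [latticePoint_add] using this
  -- level `ℓ + 1` at the points `2 ⌊2 ^ ℓ x⌋ + e`
  have h1 : Tendsto (fun ℓ : ℕ => (stationaryScheme c B).refine 1 f (ℓ + 1)
      (2 • dyadicFloor x ℓ + e)) atTop (𝓝 (g x)) := by
    have := h.tendsto (x := x) (a := fun ℓ => 2 • dyadicFloor x (ℓ - 1) + e) ?_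
    · exact (this.comp (tendsto_add_atTop_nat 1))
    · rw [← tendsto_add_atTop_iff_nat 1]
      have := (tendsto_dyadicFloor x).add ((h0.const_mul (2 : ℝ)⁻¹).smul_const (latticePoint e))
      simp only [mul_zero, zero_smul, add_zero] at this
      refine this.congr fun ℓ => ?_
      rw [Nat.add_sub_cancel, latticePoint_add, latticePoint_nsmul, smul_add, smul_smul, pow_succ,
        mul_inv]
      congr 2
      · push_cast; field_simp
      · ring
  have hfin := c.finite_setOf_ne_zero e
  have h2 : Tendsto (fun ℓ : ℕ => ∑ β ∈ hfin.toFinset, c (e - 2 • β) *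
      (stationaryScheme c B).refine 1 f ℓ (dyadicFloor x ℓ + β)) atTop
      (𝓝 (∑ β ∈ hfin.toFinset, c (e - 2 • β) * g x)) :=
    tendsto_finsetSum _ fun β _ => (h.tendsto (hshift β)).const_mul _
  have h3 : g x = ∑ β ∈ hfin.toFinset, c (e - 2 • β) * g x := by
    refine tendsto_nhds_unique h1 (h2.congr fun ℓ => ?_)
    have e1 := (c.subdiv_translate ((stationaryScheme c B).refine 1 f ℓ) (-dyadicFloor x ℓ) e).symm
    rw [show e - 2 • -dyadicFloor x ℓ = 2 • dyadicFloor x ℓ + e by rw [smul_neg]; abel] at e1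
    refine Eq.trans ?_ e1.symm
    simp only [sub_neg_eq_add]
    refine (finsum_eq_sum_of_support_subset _ fun β hβ => ?_).symm.trans ?_
    · simpa using left_ne_zero_of_mul hβ
    · exact finsum_congr fun β => by
        simp only [add_comm (dyadicFloor x ℓ)]
  rw [← Finset.sum_mul] at h3
  have h4 : ∑ β ∈ hfin.toFinset, c (e - 2 • β) = 1 := by
    have hx' : g x ≠ 0 := hx
    exact mul_right_cancel₀ hx' (by rw [one_mul]; exact h3.symm)
  rw [Pi.one_apply, ← h4]
  simp only [Mask.subdiv, Pi.one_apply, mul_one]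
  exact finsum_eq_sum_of_support_subset _ fun β hβ => by simpa using hβ

/-- The translates of the basic limit function form a partition of unity. -/
lemma limitOp_one (hR : 0 ≤ R) (hc : c.SupportedIn R)
    (h : (stationaryScheme c B).IsLimit 1 deltaData φ) (h1 : c.subdiv 1 = 1) :
    limitOp φ 1 = 1 := by
  refine (isLimit_limitOp hR hc h (f := 1) ⟨1, by simp⟩).unique
    (SubdivisionScheme.isLimit_of_eventually_le (u := fun _ => 0) continuous_const
      tendsto_const_nhds (.of_forall fun ℓ α => ?_))
  rw [refine_stationaryScheme, Function.iterate_fixed h1]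
  simp

end stationary

/-! ### Limit functions of asymptotically stationary schemes -/

lemma prod_one_add_mul_le_exp {e : ℕ → ℝ} (he0 : ∀ j, 0 ≤ e j) (he : Summable e) {K : ℝ}
    (hK : 0 ≤ K) (k ℓ : ℕ) :
    ∏ i ∈ Finset.range ℓ, (1 + K * e (k + i)) ≤ Real.exp (K * ∑' j, e j) := by
  calc _ ≤ ∏ i ∈ Finset.range ℓ, Real.exp (K * e (k + i)) := by
        refine Finset.prod_le_prod (fun i _ => ?_) fun i _ => ?_
        · have := mul_nonneg hK (he0 (k + i)); linarith
        · rw [add_comm]; exact Real.add_one_le_exp _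
    _ = Real.exp (K * ∑ i ∈ Finset.range ℓ, e (k + i)) := by
        rw [← Real.exp_sum, Finset.mul_sum]
    _ ≤ _ := by
        refine Real.exp_le_exp.2 (mul_le_mul_of_nonneg_left ?_ hK)
        have h1 : ∑ i ∈ Finset.range ℓ, e (k + i) ≤ ∑ i ∈ Finset.range (k + ℓ), e i := by
          rw [Finset.sum_range_add]
          exact le_add_of_nonneg_left (Finset.sum_nonneg fun _ _ => he0 _)
        exact h1.trans (he.sum_le_tsum _ fun _ _ => he0 _)

section asymptotic

variable {n m : ℕ} {c : Mask} {B : ZMod n → Matrix (Fin m) (Fin m) ℝ} {R : ℝ} {φ : ℝ × ℝ → ℝ}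
  {S : SubdivisionScheme n m}

/-- The tail `∑_{j > k} ‖S_{c^(j)} - S_c‖` of the distance of a scheme from a stationary one. -/
noncomputable def maskTail (S : SubdivisionScheme n m) (c : Mask) (k : ℕ) : ℝ :=
  ∑' r : ℕ, (S.mask (r + k + 1) - c).opNorm

lemma maskTail_nonneg (S : SubdivisionScheme n m) (c : Mask) (k : ℕ) : 0 ≤ maskTail S c k :=
  tsum_nonneg fun _ => Mask.opNorm_nonneg _

lemma tendsto_maskTail (S : SubdivisionScheme n m) (c : Mask) :
    Tendsto (maskTail S c) atTop (𝓝 0) :=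
  tendsto_sum_nat_add fun j => (S.mask (j + 1) - c).opNorm

lemma maskTail_eq (hS : Summable fun j => (S.mask (j + 1) - c).opNorm) (k : ℕ) :
    maskTail S c k = (S.mask (k + 1) - c).opNorm + maskTail S c (k + 1) := by
  have := ((summable_nat_add_iff k).2 hS).tsum_eq_zero_add
  simp only [zero_add] at this
  rw [maskTail, this, maskTail]
  congr 2
  ext r
  rw [add_right_comm r 1 k]
  rfl

lemma abs_subdiv_sub_le (k : ℕ) {f : ℤ × ℤ → ℝ} {M : ℝ} (hf : ∀ α, |f α| ≤ M) (α : ℤ × ℤ) :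
    |((S.mask (k + 1)).subdiv f - c.subdiv f) α| ≤ (S.mask (k + 1) - c).opNorm * M := by
  rw [← Mask.sub_subdiv]
  exact Mask.abs_subdiv_le _ hf α

/-- Uniform boundedness of the products of the subdivision operators.  In the norm
`sup_j ‖S_c ^ j f‖`, for which `S_c` is a contraction, the `k`-th operator has norm at most
`1 + K ‖S_{c^(k)} - S_c‖`. -/
lemma exists_refine_bound (hR : 0 ≤ R) (hc : c.SupportedIn R)
    (h : (stationaryScheme c B).IsLimit 1 deltaData φ)
    (hS : Summable fun j => (S.mask (j + 1) - c).opNorm) :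
    ∃ K : ℝ, 0 ≤ K ∧ ∀ (k : ℕ) (f : ℤ × ℤ → ℝ) (M : ℝ), (∀ α, |f α| ≤ M) →
      ∀ ℓ α, |S.refine (k + 1) f ℓ α| ≤ K * M := by
  obtain ⟨K, hK, hb⟩ := exists_powerBound hR hc h
  set e : ℕ → ℝ := fun j => (S.mask (j + 1) - c).opNorm with he
  have he0 : ∀ j, 0 ≤ e j := fun j => Mask.opNorm_nonneg _
  refine ⟨K * Real.exp (K * ∑' j, e j), by positivity, fun k f M hf ℓ α => ?_⟩
  have hM : 0 ≤ M := (abs_nonneg _).trans (hf 0)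
  have key : ∀ ℓ j α, |c.subdiv^[j] (S.refine (k + 1) f ℓ) α| ≤
      K * M * ∏ i ∈ Finset.range ℓ, (1 + K * e (k + i)) := by
    intro ℓ
    induction ℓ with
    | zero => intro j α; simpa [SubdivisionScheme.refine] using (hb f M hf).1 j α
    | succ ℓ ih =>
      intro j α
      set b := K * M * ∏ i ∈ Finset.range ℓ, (1 + K * e (k + i)) with hbdef
      set g := S.refine (k + 1) f ℓ with hg
      have e1 : S.refine (k + 1) f (ℓ + 1) =
          c.subdiv g + ((S.mask (k + ℓ + 1)).subdiv g - c.subdiv g) := by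
        rw [add_sub_cancel, SubdivisionScheme.refine, add_right_comm k 1 ℓ]
      have e2 : c.subdiv^[j] (S.refine (k + 1) f (ℓ + 1)) = c.subdiv^[j + 1] g +
          c.subdiv^[j] ((S.mask (k + ℓ + 1)).subdiv g - c.subdiv g) := by
        rw [e1, Function.iterate_succ_apply]
        exact iterate_map_add c.subdivLin j _ _
      have h1 := ih (j + 1) α
      have h2 := (hb _ _ (abs_subdiv_sub_le (S := S) (c := c) (k + ℓ) (ih 0))).1 j α
      rw [e2, Finset.prod_range_succ, ← mul_assoc, ← hbdef]
      calc _ ≤ b + K * (e (k + ℓ) * b) := (abs_add_le _ _).trans (add_le_add h1 h2)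
        _ = _ := by ring
  refine (key ℓ 0 α).trans ?_
  have hprod := prod_one_add_mul_le_exp he0 hS hK k ℓ
  calc _ ≤ K * M * Real.exp (K * ∑' j, e j) :=
        mul_le_mul_of_nonneg_left hprod (mul_nonneg hK hM)
    _ = _ := by ring

/-- A scheme at summable distance from a convergent stationary scheme has limit functions for
bounded data given at any level, and these are close to the limit functions of the stationary
scheme when the level is high.  The limit function is the uniform limit, as `i → ∞`, of the
stationary limit functions of the data refined over `i` levels. -/
theorem exists_isLimit (hR : 0 ≤ R) (hc : c.SupportedIn R)
    (h : (stationaryScheme c B).IsLimit 1 deltaData φ)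
    (hS : Summable fun j => (S.mask (j + 1) - c).opNorm) :
    ∃ D : ℝ, ∀ (k : ℕ) (f : ℤ × ℤ → ℝ) (M : ℝ), (∀ α, |f α| ≤ M) →
      ∃ g, S.IsLimit (k + 1) f g ∧ ∀ x, |g x - limitOp φ f x| ≤ D * M * maskTail S c k := by
  have hφ : ∀ x, R < ‖x‖ → φ x = 0 := fun x hx => h.eq_zero_of_norm_gt hR (fun _ _ => hc) hx
  obtain ⟨K, hK, hb⟩ := exists_powerBound hR hc h
  obtain ⟨K', hK', hb'⟩ := exists_refine_bound hR hc h hS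
  obtain ⟨η, hη, hle⟩ := exists_rate hR hc h
  refine ⟨K * K', fun k f M hf => ?_⟩
  have hM : 0 ≤ M := (abs_nonneg _).trans (hf 0)
  set D := K * K' * M with hD
  have hD0 : 0 ≤ D := by positivity
  set G : ℕ → ℤ × ℤ → ℝ := S.refine (k + 1) f with hG
  have hGb : ∀ i α, |G i α| ≤ K' * M := hb' k f M hf
  have hGs : ∀ i, G (i + 1) = (S.mask (k + i + 1)).subdiv (G i) := fun i => by
    rw [hG, SubdivisionScheme.refine, add_right_comm k 1 i]
  have hstep : ∀ i α, |(G (i + 1) - c.subdiv (G i)) α| ≤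
      (S.mask (k + i + 1) - c).opNorm * (K' * M) := fun i α => by
    rw [hGs]; exact abs_subdiv_sub_le _ (hGb i) α
  -- stationary refinement from level `i` on
  have hdiff : ∀ j i α, |G (i + j) α - c.subdiv^[j] (G i) α| ≤ D * maskTail S c (k + i) := by
    intro j
    induction j with
    | zero => intro i α; simpa using mul_nonneg hD0 (maskTail_nonneg S c (k + i))
    | succ j ih =>
      intro i α
      have h1 := ih (i + 1) α
      have h2 := (hb _ _ (hstep i)).1 j α
      rw [iterate_subdiv_sub, Pi.sub_apply] at h2
      rw [show i + (j + 1) = i + 1 + j by ring, Function.iterate_succ_apply, maskTail_eq hS]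
      calc _ ≤ |G (i + 1 + j) α - c.subdiv^[j] (G (i + 1)) α| +
            |c.subdiv^[j] (G (i + 1)) α - c.subdiv^[j] (c.subdiv (G i)) α| :=
            abs_sub_le _ _ _
        _ ≤ D * maskTail S c (k + (i + 1)) + K * ((S.mask (k + i + 1) - c).opNorm * (K' * M)) :=
            add_le_add h1 h2
        _ = _ := by rw [hD, ← add_assoc]; ring
  set F : ℕ → ℝ × ℝ → ℝ := fun i x => limitOp φ (G i) ((2 : ℝ) ^ i • x) with hF
  have hFstep : ∀ x i, dist (F i x) (F (i + 1) x) ≤ D * (S.mask (i + k + 1) - c).opNorm := by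
    intro x i
    have e : F i x = limitOp φ (c.subdiv (G i)) ((2 : ℝ) ^ (i + 1) • x) := by
      rw [pow_succ', mul_smul, limitOp_subdiv hR hc h ⟨_, hGb i⟩]
    have h2 := (hb _ _ (hstep i)).2 ((2 : ℝ) ^ (i + 1) • x)
    rw [limitOp_sub hφ] at h2
    rw [dist_comm, Real.dist_eq, e, add_comm i k]
    exact h2.trans_eq (by rw [hD]; ring)
  have hsum : Summable fun i => D * (S.mask (i + k + 1) - c).opNorm :=
    ((summable_nat_add_iff k).2 hS).mul_left D
  choose g hg using fun x =>
    cauchySeq_tendsto_of_complete (cauchySeq_of_dist_le_of_summable _ (hFstep x) hsum)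
  have hgF : ∀ i x, |g x - F i x| ≤ D * maskTail S c (k + i) := by
    intro i x
    have := dist_le_tsum_of_dist_le_of_tendsto _ (hFstep x) hsum (hg x) i
    rw [dist_comm, Real.dist_eq, tsum_mul_left] at this
    refine this.trans_eq ?_
    rw [maskTail]
    congr 2
    ext r
    rw [show i + r + k = r + (k + i) by ring]
  have htail : Tendsto (fun i => D * maskTail S c (k + i)) atTop (𝓝 0) := by
    have := (tendsto_maskTail S c).comp (tendsto_add_atTop_nat k)
    simpa [Function.comp_def, add_comm] using this.const_mul D
  have hcont : Continuous g := by
    have hunif : TendstoUniformly F g atTop := by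
      rw [Metric.tendstoUniformly_iff]
      intro ε hε
      filter_upwards [htail.eventually (gt_mem_nhds hε)] with i hi x
      rw [Real.dist_eq]
      exact (hgF i x).trans_lt hi
    refine hunif.continuous (Frequently.of_forall fun i => ?_)
    exact (continuous_limitOp hφ h.1 (G i)).comp (continuous_const_smul _)
  refine ⟨g, ?_, fun x => ?_⟩
  · -- level `ℓ` is reached by `i = ℓ / 2` steps of the scheme and `ℓ - i` stationary steps
    have hi : Tendsto (fun ℓ : ℕ => ℓ / 2) atTop atTop := Nat.tendsto_div_const_atTop two_ne_zero
    have hj : Tendsto (fun ℓ : ℕ => ℓ - ℓ / 2) atTop atTop :=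
      tendsto_atTop_mono (fun ℓ => by omega) hi
    refine SubdivisionScheme.isLimit_of_eventually_le hcont
      (u := fun ℓ => η (ℓ - ℓ / 2) * (K' * M) + 2 * (D * maskTail S c (k + ℓ / 2))) ?_ ?_
    · simpa using ((hη.comp hj).mul_const (K' * M)).add ((htail.comp hi).const_mul 2)
    · filter_upwards [hj.eventually hle] with ℓ hℓ α
      have hsplit : ℓ / 2 + (ℓ - ℓ / 2) = ℓ := by omega
      generalize ℓ / 2 = i at *
      generalize ℓ - i = j at *
      subst hsplit
      have h1 := hgF i (((2 : ℝ) ^ (i + j))⁻¹ • latticePoint α)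
      have h2 := hℓ (G i) (K' * M) (hGb i) α
      have h3 := hdiff j i α
      have e : F i (((2 : ℝ) ^ (i + j))⁻¹ • latticePoint α) =
          limitOp φ (G i) (((2 : ℝ) ^ j)⁻¹ • latticePoint α) := by
        rw [hF]
        dsimp only
        rw [smul_smul, pow_add, mul_inv, ← mul_assoc, mul_inv_cancel₀ (by positivity), one_mul]
      rw [e] at h1
      rw [abs_sub_comm] at h3
      have h4 := abs_sub_le (g (((2 : ℝ) ^ (i + j))⁻¹ • latticePoint α))
        (limitOp φ (G i) (((2 : ℝ) ^ j)⁻¹ • latticePoint α)) (G (i + j) α)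
      have h5 := abs_sub_le (limitOp φ (G i) (((2 : ℝ) ^ j)⁻¹ • latticePoint α))
        (c.subdiv^[j] (G i) α) (G (i + j) α)
      linarith
  · have := hgF 0 x
    simpa [hF, hG, SubdivisionScheme.refine] using this

end asymptotic

/-! ### Convergence of matrix powers tested by functionals -/

lemma isNilpotent_of_forall_hasEigenvalue_eq_zero {V : Type*} [AddCommGroup V] [Module ℂ V]
    [FiniteDimensional ℂ V] (T : Module.End ℂ V) (h : ∀ μ, T.HasEigenvalue μ → μ = 0) :
    IsNilpotent T := by
  have h0 : T.maxGenEigenspace 0 = ⊤ := by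
    rw [eq_top_iff, ← Module.End.iSup_maxGenEigenspace_eq_top T]
    refine iSup_le fun μ => ?_
    by_cases hμ : μ = 0
    · rw [hμ]
    · have : T.maxGenEigenspace μ = ⊥ := by
        by_contra hne
        rw [Module.End.maxGenEigenspace_eq] at hne
        exact hμ (h μ (Module.End.hasEigenvalue_of_hasGenEigenvalue hne))
      rw [this]; exact bot_le
  rw [Module.End.maxGenEigenspace_eq_genEigenspace_finrank] at h0
  refine ⟨Module.finrank ℂ V, LinearMap.ext fun v => ?_⟩
  have hv : v ∈ T.genEigenspace 0 (Module.finrank ℂ V) := h0 ▸ Submodule.mem_top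
  simpa [Module.End.mem_genEigenspace_nat] using hv

section powers

variable {ι σ : Type*} [Fintype ι] [DecidableEq ι]

/-- If no complex eigenvector of `A` with nonzero eigenvalue is annihilated by all functionals
`ρ s`, then some power of `A` annihilates every vector whose whole orbit is annihilated. -/
lemma exists_pow_mulVec_eq_zero (A : Matrix ι ι ℝ) (ρ : σ → Module.Dual ℝ (ι → ℝ))
    (hA : ∀ (μ : ℂ) (v : ι → ℂ), μ ≠ 0 → v ≠ 0 →
      A.map (fun t : ℝ => (t : ℂ)) *ᵥ v = μ • v →
      ∃ s, ρ s (fun q => (v q).re) ≠ 0 ∨ ρ s (fun q => (v q).im) ≠ 0) :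
    ∃ N : ℕ, ∀ v : ι → ℝ, (∀ j s, ρ s (A ^ j *ᵥ v) = 0) → A ^ N *ᵥ v = 0 := by
  set Ac : Matrix ι ι ℂ := A.map (fun t : ℝ => (t : ℂ)) with hAc
  have hre : ∀ z : ι → ℂ, (fun q => ((Ac *ᵥ z) q).re) = A *ᵥ fun q => (z q).re := by
    intro z; ext q
    simp [hAc, Matrix.mulVec, dotProduct, Complex.re_sum]
  have him : ∀ z : ι → ℂ, (fun q => ((Ac *ᵥ z) q).im) = A *ᵥ fun q => (z q).im := by
    intro z; ext q
    simp [hAc, Matrix.mulVec, dotProduct, Complex.im_sum]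
  -- the vectors whose orbit is annihilated, and their complexification
  let P : Submodule ℝ (ι → ℝ) := ⨅ (j : ℕ) (s : σ), LinearMap.ker (ρ s ∘ₗ (A ^ j).mulVecLin)
  have hP : ∀ v, v ∈ P ↔ ∀ j s, ρ s (A ^ j *ᵥ v) = 0 := by
    intro v; simp [P, Submodule.mem_iInf]
  have hPA : ∀ v ∈ P, A *ᵥ v ∈ P := by
    intro v hv
    rw [hP] at hv ⊢
    intro j s
    rw [Matrix.mulVec_mulVec, ← pow_succ]
    exact hv (j + 1) s
  let Q : Submodule ℂ (ι → ℂ) :=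
    { carrier := {z | (fun q => (z q).re) ∈ P ∧ (fun q => (z q).im) ∈ P}
      add_mem' := fun {y z} hy hz => ⟨P.add_mem hy.1 hz.1, P.add_mem hy.2 hz.2⟩
      zero_mem' := ⟨P.zero_mem, P.zero_mem⟩
      smul_mem' := by
        rintro a z ⟨h1, h2⟩
        have e1 : (fun q => ((a • z) q).re) =
            a.re • (fun q => (z q).re) - a.im • (fun q => (z q).im) := by
          ext q; simp
        have e2 : (fun q => ((a • z) q).im) =
            a.re • (fun q => (z q).im) + a.im • (fun q => (z q).re) := by
          ext q; simp
        refine ⟨?_, ?_⟩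
        · rw [e1]; exact P.sub_mem (P.smul_mem _ h1) (P.smul_mem _ h2)
        · rw [e2]; exact P.add_mem (P.smul_mem _ h2) (P.smul_mem _ h1) }
  have hQA : ∀ z ∈ Q, Ac.mulVecLin z ∈ Q := by
    rintro z ⟨h1, h2⟩
    refine ⟨?_, ?_⟩
    · rw [Matrix.mulVecLin_apply, hre]; exact hPA _ h1
    · rw [Matrix.mulVecLin_apply, him]; exact hPA _ h2
  obtain ⟨N, hN⟩ := isNilpotent_of_forall_hasEigenvalue_eq_zero (Ac.mulVecLin.restrict hQA) <| by
    intro μ hμ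
    by_contra hμ0
    obtain ⟨z, hz⟩ := hμ.exists_hasEigenvector
    have hz1 : Ac *ᵥ (z : ι → ℂ) = μ • (z : ι → ℂ) := congrArg Subtype.val hz.apply_eq_smul
    have hz0 : (z : ι → ℂ) ≠ 0 := fun h => hz.2 (Subtype.ext h)
    obtain ⟨s, hs⟩ := hA μ z hμ0 hz0 hz1
    have h1 := (hP _).1 z.2.1 0 s
    have h2 := (hP _).1 z.2.2 0 s
    rw [pow_zero, Matrix.one_mulVec] at h1 h2
    exact hs.elim (fun h => h h1) fun h => h h2
  refine ⟨N, fun v hv => ?_⟩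
  have hvQ : (fun q => (v q : ℂ)) ∈ Q := by
    refine ⟨?_, ?_⟩
    · simpa using (hP v).2 hv
    · have e : (fun q => ((v q : ℂ)).im) = 0 := by ext q; simp
      exact e ▸ P.zero_mem
  have h1 := congrArg Subtype.val (LinearMap.congr_fun hN ⟨_, hvQ⟩)
  rw [Module.End.pow_restrict] at h1
  have h2 : ∀ N : ℕ, (Ac.mulVecLin ^ N) (fun q => (v q : ℂ)) =
      fun q => (((A ^ N *ᵥ v) q : ℝ) : ℂ) := by
    intro N
    induction N with
    | zero => simp
    | succ N ih =>
      rw [pow_succ', Module.End.mul_apply, ih, pow_succ', ← Matrix.mulVec_mulVec]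
      ext q
      simp [hAc, Matrix.mulVec, dotProduct]
  ext q
  have h3 := congrFun h1 q
  simp only [LinearMap.restrict_apply, h2] at h3
  simpa using h3

lemma pow_mulVec_one {A : Matrix ι ι ℝ} (h1 : A *ᵥ 1 = 1) (k : ℕ) : A ^ k *ᵥ 1 = 1 := by
  induction k with
  | zero => simp
  | succ k ih => rw [pow_succ, ← Matrix.mulVec_mulVec, h1, ih]

/-- Let `A` fix the vector `1`, let the functionals `ρ s` take the value `1` at `1`, and let
`ρ s (A ^ k v)` converge to a limit which does not depend on `s`.  If no eigenvector with nonzero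
eigenvalue is annihilated by all `ρ s`, the powers of `A` converge to a matrix with equal rows.
By duality the coordinates of `A ^ N v` are combinations of the numbers `ρ s (A ^ j v)` for
large `N`. -/
theorem exists_tendsto_pow (A : Matrix ι ι ℝ) (ρ : σ → Module.Dual ℝ (ι → ℝ))
    (h1 : A *ᵥ 1 = 1) (hρ : ∀ s, ρ s 1 = 1)
    (hlim : ∀ v, ∃ p, ∀ s, Tendsto (fun k : ℕ => ρ s (A ^ k *ᵥ v)) atTop (𝓝 p))
    (hA : ∀ (μ : ℂ) (v : ι → ℂ), μ ≠ 0 → v ≠ 0 →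
      A.map (fun t : ℝ => (t : ℂ)) *ᵥ v = μ • v →
      ∃ s, ρ s (fun q => (v q).re) ≠ 0 ∨ ρ s (fun q => (v q).im) ≠ 0) :
    ∃ w : ι → ℝ, Tendsto (fun k : ℕ => A ^ k) atTop (𝓝 (Matrix.of fun _ => w)) := by
  choose p hp using hlim
  have hpow1 := pow_mulVec_one h1
  obtain ⟨N, hN⟩ := exists_pow_mulVec_eq_zero A ρ hA
  let U : Submodule ℝ (Module.Dual ℝ (ι → ℝ)) :=
    Submodule.span ℝ (Set.range fun js : ℕ × σ => ρ js.2 ∘ₗ (A ^ js.1).mulVecLin)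
  have hU : ∀ ψ ∈ U, ∀ v, Tendsto (fun k : ℕ => ψ (A ^ k *ᵥ v)) atTop (𝓝 (ψ 1 * p v)) := by
    intro ψ hψ v
    induction hψ using Submodule.span_induction with
    | mem ψ hψ =>
      obtain ⟨⟨j, s⟩, rfl⟩ := hψ
      have := (hp v s).comp (tendsto_add_atTop_nat j)
      simp only [LinearMap.comp_apply, Matrix.mulVecLin_apply, hpow1, hρ, one_mul]
      refine this.congr fun k => ?_
      rw [Function.comp_apply, Matrix.mulVec_mulVec, ← pow_add, add_comm]
    | zero => simp
    | add ψ χ _ _ h h' => simpa [add_mul] using h.add h'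
    | smul a ψ _ h => simpa [mul_assoc] using h.const_mul a
  have hcoord : ∀ q, (LinearMap.proj q : Module.Dual ℝ (ι → ℝ)) ∘ₗ (A ^ N).mulVecLin ∈ U := by
    intro q
    rw [← Subspace.dualCoannihilator_dualAnnihilator_eq (W := U), Submodule.mem_dualAnnihilator]
    intro v hv
    rw [Submodule.mem_dualCoannihilator] at hv
    have := hN v fun j s => hv _ (Submodule.subset_span ⟨(j, s), rfl⟩)
    simp [this]
  have hconv : ∀ v q, Tendsto (fun k : ℕ => (A ^ k *ᵥ v) q) atTop (𝓝 (p v)) := by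
    intro v q
    have := hU _ (hcoord q) v
    simp only [LinearMap.comp_apply, Matrix.mulVecLin_apply, hpow1, LinearMap.proj_apply,
      Pi.one_apply, one_mul, Matrix.mulVec_mulVec, ← pow_add] at this
    rw [← tendsto_add_atTop_iff_nat N]
    exact this.congr fun k => by rw [add_comm]
  refine ⟨fun r => p (Pi.single r 1), ?_⟩
  refine tendsto_pi_nhds.2 fun q => tendsto_pi_nhds.2 fun r => ?_
  simpa using hconv (Pi.single r 1) q

/-- The common row of the limit of the powers of `A` is the only fixed row vector with sum `1`. -/
lemma fixedRow_of_tendsto_pow [Nonempty ι] {A : Matrix ι ι ℝ} (h1 : A *ᵥ 1 = 1) {w : ι → ℝ}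
    (hw : Tendsto (fun k : ℕ => A ^ k) atTop (𝓝 (Matrix.of fun _ => w))) :
    Aᵀ *ᵥ w = w ∧ w ⬝ᵥ 1 = 1 ∧ ∀ u, Aᵀ *ᵥ u = u → u ⬝ᵥ 1 = 1 → u = w := by
  have hcont : ∀ (u v : ι → ℝ), Tendsto (fun k : ℕ => u ⬝ᵥ (A ^ k *ᵥ v)) atTop
      (𝓝 (u ⬝ᵥ ((Matrix.of fun _ => w) *ᵥ v))) := by
    intro u v
    have hc : Continuous fun M : Matrix ι ι ℝ => u ⬝ᵥ (M *ᵥ v) := by fun_prop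
    exact (hc.tendsto _).comp hw
  have hlim : ∀ u v : ι → ℝ, u ⬝ᵥ ((Matrix.of fun _ => w) *ᵥ v) = (u ⬝ᵥ 1) * (w ⬝ᵥ v) := by
    intro u v
    have : (Matrix.of fun _ : ι => w) *ᵥ v = (w ⬝ᵥ v) • (1 : ι → ℝ) := by
      ext q; simp [Matrix.mulVec]
    rw [this, dotProduct_smul, smul_eq_mul, mul_comm]
  have hpow1 := pow_mulVec_one h1
  obtain ⟨q₀⟩ := ‹Nonempty ι›
  have hq : (Pi.single q₀ 1 : ι → ℝ) ⬝ᵥ 1 = 1 := by simp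
  refine ⟨?_, ?_, fun u hu hu1 => ?_⟩
  · ext r
    have ha := hcont (Pi.single q₀ 1) (A *ᵥ Pi.single r 1)
    have hb := (hcont (Pi.single q₀ 1) (Pi.single r 1)).comp (tendsto_add_atTop_nat 1)
    rw [hlim, hq, one_mul] at ha hb
    have := tendsto_nhds_unique ha (hb.congr fun k => by
      rw [Function.comp_apply, pow_succ, Matrix.mulVec_mulVec])
    rw [Matrix.dotProduct_mulVec] at this
    simpa [Matrix.mulVec_transpose] using this
  · have ha := hcont (Pi.single q₀ 1) 1
    simp only [hpow1] at ha
    rw [hlim, hq, one_mul] at ha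
    exact (tendsto_nhds_unique ha tendsto_const_nhds)
  · have hfix : ∀ k : ℕ, u ᵥ* A ^ k = u := by
      intro k
      induction k with
      | zero => simp
      | succ k ih =>
        rw [pow_succ', ← Matrix.vecMul_vecMul, ← Matrix.mulVec_transpose A, hu, ih]
    ext r
    have ha := hcont u (Pi.single r 1)
    simp only [Matrix.dotProduct_mulVec u (A ^ _), hfix] at ha
    rw [hlim, hu1, one_mul] at ha
    simpa using tendsto_nhds_unique tendsto_const_nhds ha

end powers

/-! ### Products of summably perturbed factors -/

section products

variable {𝔸 : Type*} [NormedRing 𝔸] {A : 𝔸} {s P : ℕ → 𝔸}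

/-- Products of factors at summable distance from a power-bounded `A` are bounded: in the norm
`sup_j ‖A ^ j x‖`, the `k`-th factor has norm at most `1 + K ‖s k - A‖`. -/
lemma exists_product_bound (hP0 : P 0 = 1) (hP : ∀ k, P (k + 1) = s (k + 1) * P k)
    {K : ℝ} (hA : ∀ j : ℕ, ‖A ^ j‖ ≤ K) (hs : Summable fun j => ‖s (j + 1) - A‖) :
    ∃ K' : ℝ, ∀ k, ‖P k‖ ≤ K' := by
  have hK : 0 ≤ K := (norm_nonneg _).trans (hA 0)
  have key : ∀ k j : ℕ, ‖A ^ j * P k‖ ≤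
      K * ∏ i ∈ Finset.range k, (1 + K * ‖s (i + 1) - A‖) := by
    intro k
    induction k with
    | zero => intro j; simpa [hP0] using hA j
    | succ k ih =>
      intro j
      set b := K * ∏ i ∈ Finset.range k, (1 + K * ‖s (i + 1) - A‖) with hb
      have e : A ^ j * P (k + 1) = A ^ (j + 1) * P k + A ^ j * ((s (k + 1) - A) * P k) := by
        rw [hP, pow_succ]; noncomm_ring
      have h0 : ‖P k‖ ≤ b := by simpa using ih 0
      have h2 : ‖A ^ j * ((s (k + 1) - A) * P k)‖ ≤ K * (‖s (k + 1) - A‖ * b) :=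
        (norm_mul_le _ _).trans (mul_le_mul (hA j) ((norm_mul_le _ _).trans
          (mul_le_mul_of_nonneg_left h0 (norm_nonneg _))) (norm_nonneg _) hK)
      rw [e, Finset.prod_range_succ, ← mul_assoc K, ← hb]
      calc _ ≤ b + K * (‖s (k + 1) - A‖ * b) :=
            (norm_add_le _ _).trans (add_le_add (ih (j + 1)) h2)
        _ = _ := by ring
  refine ⟨K * Real.exp (K * ∑' j, ‖s (j + 1) - A‖), fun k => ?_⟩
  have h1 := key k 0
  rw [pow_zero, one_mul] at h1
  have h2 := prod_one_add_mul_le_exp (fun j => norm_nonneg (s (j + 1) - A)) hs hK 0 k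
  simp only [zero_add] at h2
  exact h1.trans (mul_le_mul_of_nonneg_left h2 hK)

/-- Dominated convergence for the accumulated perturbation of a product. -/
lemma exists_tendsto_perturbation [CompleteSpace 𝔸] (hP0 : P 0 = 1)
    (hP : ∀ k, P (k + 1) = s (k + 1) * P k) {L : 𝔸}
    (hA : Tendsto (fun j : ℕ => A ^ j) atTop (𝓝 L)) (hs : Summable fun j => ‖s (j + 1) - A‖) :
    ∃ Z : 𝔸, Tendsto (fun k => ∑ j ∈ Finset.range k, A ^ (k - (j + 1)) * (s (j + 1) - A) * P j)
      atTop (𝓝 (L * Z)) := by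
  obtain ⟨K, hK⟩ := hA.norm.bddAbove_range
  replace hK : ∀ j : ℕ, ‖A ^ j‖ ≤ K := fun j => hK ⟨j, rfl⟩
  have hK0 : 0 ≤ K := (norm_nonneg _).trans (hK 0)
  obtain ⟨K', hK'⟩ := exists_product_bound hP0 hP hK hs
  have hsum : Summable fun j => (s (j + 1) - A) * P j :=
    Summable.of_norm_bounded (hs.mul_right K') fun j => (norm_mul_le _ _).trans
      (mul_le_mul_of_nonneg_left (hK' j) (norm_nonneg _))
  refine ⟨∑' j, (s (j + 1) - A) * P j, ?_⟩
  rw [← hsum.tsum_mul_left]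
  have hlim := tendsto_tsum_of_dominated_convergence (𝓕 := atTop)
    (f := fun k j => if j < k then A ^ (k - (j + 1)) * ((s (j + 1) - A) * P j) else 0)
    (g := fun j => L * ((s (j + 1) - A) * P j))
    (bound := fun j => K * (‖s (j + 1) - A‖ * K')) ((hs.mul_right K').mul_left K) ?_ ?_
  · refine hlim.congr fun k => ?_
    rw [tsum_eq_sum (s := Finset.range k) fun j hj => if_neg (by simpa using hj)]
    refine Finset.sum_congr rfl fun j hj => ?_
    rw [if_pos (Finset.mem_range.1 hj), mul_assoc]
  · intro j
    have h1 := (hA.comp (tendsto_sub_atTop_nat (j + 1))).mul_const ((s (j + 1) - A) * P j)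
    refine h1.congr' ?_
    filter_upwards [eventually_gt_atTop j] with k hk
    rw [if_pos hk]; rfl
  · refine .of_forall fun k j => ?_
    split_ifs
    · exact (norm_mul_le _ _).trans (mul_le_mul (hK _) ((norm_mul_le _ _).trans
        (mul_le_mul_of_nonneg_left (hK' j) (norm_nonneg _))) (norm_nonneg _) hK0)
    · rw [norm_zero]
      exact mul_nonneg hK0 (mul_nonneg (norm_nonneg _) ((norm_nonneg _).trans (hK' j)))

end products

/-! ### The rings around the extraordinary element -/

section rings

variable {n m : ℕ} {net : ControlNet n m} {S : SubdivisionScheme n m} {c : Mask}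
  {B : ZMod n → Matrix (Fin m) (Fin m) ℝ} {R : ℝ} {φ : ℝ × ℝ → ℝ}

/-- The value at `x` of the first ring over the `i`-th cell of sector `l`, as a functional of the
(scalar) control points.  The sum runs over the lattice points within distance `R` of `x`, which
are all that matter when `φ` vanishes outside the ball of radius `R`. -/
noncomputable def ringFunctional (net : ControlNet n m) (φ : ℝ × ℝ → ℝ) (R : ℝ) (l : ZMod n)
    (i : Fin 3) (x : ℝ × ℝ) : Module.Dual ℝ (ZMod n × Fin m → ℝ) :=
  ∑ α ∈ nearby R x, φ (x - latticePoint α) • LinearMap.proj (net.label l i α)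

lemma ringFunctional_apply (l : ZMod n) (i : Fin 3) (x : ℝ × ℝ) (v : ZMod n × Fin m → ℝ) :
    ringFunctional net φ R l i x v =
      ∑ α ∈ nearby R x, φ (x - latticePoint α) * v (net.label l i α) := by
  simp [ringFunctional, LinearMap.sum_apply]

lemma basicLimit_stationaryScheme (h : (stationaryScheme c B).IsLimit 1 deltaData φ) (k : ℕ) :
    (stationaryScheme c B).basicLimit k = φ := by
  have h' : (stationaryScheme c B).IsLimit k deltaData φ := by
    simpa only [SubdivisionScheme.IsLimit, refine_stationaryScheme] using h
  exact (SubdivisionScheme.isLimit_basicLimit ⟨φ, h'⟩).unique h'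

variable [NeZero n]

lemma perturbation_eq_sum (A : Matrix (ZMod n × Fin m) (ZMod n × Fin m) ℝ)
    (d : Matrix (ZMod n × Fin m) (Fin 3) ℝ) (k : ℕ) :
    perturbation S A d k =
      (∑ j ∈ Finset.range k, A ^ (k - (j + 1)) * (S.mat (j + 1) - A) * S.matProd j) * d := by
  rw [perturbation, Matrix.sum_mul, Finset.range_eq_Ico]
  refine Eq.trans (Finset.sum_congr ?_ fun _ _ => rfl) (Finset.sum_Ico_add'
    (fun j => A ^ (k - j) * (S.mat j - A) * S.matProd (j - 1) * d) 0 k 1).symm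
  ext j
  simp only [Finset.mem_Icc, Finset.mem_Ico]
  omega

lemma points_eq_add_perturbation (A : Matrix (ZMod n × Fin m) (ZMod n × Fin m) ℝ)
    (d : Matrix (ZMod n × Fin m) (Fin 3) ℝ) (k : ℕ) :
    S.points d k = A ^ k * d + perturbation S A d k := by
  rw [perturbation_eq_sum, ← Matrix.add_mul, SubdivisionScheme.points]
  congr 1
  induction k with
  | zero => simp [SubdivisionScheme.matProd]
  | succ k ih =>
    have h : ∑ j ∈ Finset.range k, A ^ (k + 1 - (j + 1)) * (S.mat (j + 1) - A) * S.matProd j =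
        A * ∑ j ∈ Finset.range k, A ^ (k - (j + 1)) * (S.mat (j + 1) - A) * S.matProd j := by
      rw [Finset.mul_sum]
      refine Finset.sum_congr rfl fun j hj => ?_
      rw [show k + 1 - (j + 1) = k - (j + 1) + 1 by have := Finset.mem_range.1 hj; omega, pow_succ']
      simp only [mul_assoc]
    have h0 : S.mat (k + 1) * S.matProd k =
        A * S.matProd k + (S.mat (k + 1) - A) * S.matProd k := by
      rw [sub_mul, add_sub_cancel]
    rw [Finset.sum_range_succ, h, SubdivisionScheme.matProd, h0]
    nth_rw 1 [ih]
    simp only [Nat.sub_self, pow_zero, one_mul, mul_add, pow_succ', add_assoc]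

/-- The rings shrink to `p` when all control points tend to `p` and the basic limit functions
tend uniformly to a function whose translates form a partition of unity. -/
lemma ringsTendTo_of_tendsto_points (hR : 0 ≤ R)
    (hφ : ∀ x, R < ‖x‖ → φ x = 0) (hφc : Continuous φ) (hφ1 : limitOp φ 1 = 1)
    (hS : ∀ k x, R < ‖x‖ → S.basicLimit (k + 1) x = 0) {δ : ℕ → ℝ} (hδ : Tendsto δ atTop (𝓝 0))
    (hle : ∀ k x, |S.basicLimit (k + 1) x - φ x| ≤ δ k)
    {d : Matrix (ZMod n × Fin m) (Fin 3) ℝ} {p : Fin 3 → ℝ}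
    (hd : ∀ q, Tendsto (fun k => S.points d k q) atTop (𝓝 p)) : S.RingsTendTo net d p := by
  obtain ⟨Φ, hΦ0, hΦ⟩ := exists_bound_of_compactSupport hφ hφc
  set e : ℕ → ℝ := fun k => ∑ q, ‖S.points d k q - p‖ with he
  have he0 : Tendsto e atTop (𝓝 0) := by
    have : Tendsto e atTop (𝓝 (∑ _q : ZMod n × Fin m, 0)) :=
      tendsto_finsetSum _ fun q _ => by
        simpa using ((hd q).sub_const p).norm
    simpa using this
  have hq : ∀ k q, ‖S.points d k q - p‖ ≤ e k := fun k q =>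
    Finset.single_le_sum (f := fun q => ‖S.points d k q - p‖) (fun _ _ => norm_nonneg _)
      (Finset.mem_univ q)
  have hen : ∀ k, 0 ≤ e k := fun k => Finset.sum_nonneg fun _ _ => norm_nonneg _
  have hb : ∀ k l i x, ‖S.ring net d k l i x - p‖ ≤
      (2 * R + 1) ^ 2 * (δ k * (‖p‖ + e k) + Φ * e k) := by
    intro k l i x
    set y := (2 : ℝ) ^ k • x with hy
    have hδ0 : 0 ≤ δ k := (abs_nonneg _).trans (hle k 0)
    have e1 : S.ring net d k l i x = ∑ α ∈ nearby R y,
        S.basicLimit (k + 1) (y - latticePoint α) • S.points d k (net.label l i α) :=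
      finsum_eq_sum_of_support_subset _ fun α hα =>
        support_translates_subset (hS k) y (left_ne_zero_of_smul hα)
    have e2 : p = ∑ α ∈ nearby R y, φ (y - latticePoint α) • p := by
      have := congrFun hφ1 y
      rw [limitOp_eq_sum hφ 1 (Finset.Subset.refl _)] at this
      simp only [Pi.one_apply, mul_one] at this
      rw [← Finset.sum_smul, this, one_smul]
    have e3 : S.ring net d k l i x - p = ∑ α ∈ nearby R y,
        ((S.basicLimit (k + 1) (y - latticePoint α) - φ (y - latticePoint α)) •
            S.points d k (net.label l i α) +
          φ (y - latticePoint α) • (S.points d k (net.label l i α) - p)) := by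
      rw [e1]
      nth_rw 1 [e2]
      rw [← Finset.sum_sub_distrib]
      refine Finset.sum_congr rfl fun α _ => ?_
      rw [sub_smul, smul_sub]; abel
    rw [e3]
    calc _ ≤ ∑ α ∈ nearby R y, (δ k * (‖p‖ + e k) + Φ * e k) := by
          refine norm_sum_le_of_le _ fun α _ => (norm_add_le _ _).trans (add_le_add ?_ ?_)
          · rw [norm_smul]
            refine mul_le_mul (hle _ _) ?_ (norm_nonneg _) hδ0
            calc ‖S.points d k (net.label l i α)‖
                = ‖p + (S.points d k (net.label l i α) - p)‖ := by rw [add_sub_cancel]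
              _ ≤ _ := (norm_add_le _ _).trans (add_le_add le_rfl (hq _ _))
          · rw [norm_smul]
            exact mul_le_mul (hΦ _) (hq _ _) (norm_nonneg _) hΦ0
      _ = (nearby R y).card * (δ k * (‖p‖ + e k) + Φ * e k) := by
          rw [Finset.sum_const, nsmul_eq_mul]
      _ ≤ _ := by
          have := hen k
          exact mul_le_mul_of_nonneg_right (card_nearby_le hR y) (by positivity)
  have hu : Tendsto (fun k => (2 * R + 1) ^ 2 * (δ k * (‖p‖ + e k) + Φ * e k)) atTop (𝓝 0) := by
    simpa using ((hδ.mul (he0.const_add ‖p‖)).add (he0.const_mul Φ)).const_mul ((2 * R + 1) ^ 2)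
  have hu' := ENNReal.tendsto_ofReal hu
  rw [ENNReal.ofReal_zero] at hu'
  refine tendsto_of_tendsto_of_tendsto_of_le_of_le tendsto_const_nhds hu' (fun _ => zero_le)
    fun k => iSup_le fun l => iSup_le fun i => iSup_le fun x => iSup_le fun _ => ?_
  rw [← ofReal_norm]
  exact ENNReal.ofReal_le_ofReal (hb k l i x)

lemma matProd_stationaryScheme (k : ℕ) :
    (stationaryScheme c B).matProd k = blockCirculant B ^ k := by
  induction k with
  | zero => rfl
  | succ k ih => rw [SubdivisionScheme.matProd, ih, pow_succ']; rfl

/-- Convergence of a stationary scheme near the extraordinary element gives convergence of the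
first rings with the control points `S ^ k v`, which are the rings of all levels, rescaled. -/
lemma exists_tendsto_ringFunctional (h : (stationaryScheme c B).IsLimit 1 deltaData φ)
    (hφ : ∀ x, R < ‖x‖ → φ x = 0)
    (hirr : (stationaryScheme c B).ConvergentIrregular net) (v : ZMod n × Fin m → ℝ) :
    ∃ p : ℝ, ∀ (l : ZMod n) (i : Fin 3), ∀ x ∈ net.cell 0 i,
      Tendsto (fun k : ℕ => ringFunctional net φ R l i x (blockCirculant B ^ k *ᵥ v))
        atTop (𝓝 p) := by
  set T := stationaryScheme c B with hT
  set d : Matrix (ZMod n × Fin m) (Fin 3) ℝ := Matrix.of fun q _ => v q with hd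
  obtain ⟨p, hp⟩ := hirr.2.2 d
  refine ⟨p 0, fun l i x hx => ?_⟩
  have hcell : ∀ k : ℕ, ((2 : ℝ) ^ k)⁻¹ • x ∈ net.cell k i := by
    intro k
    simp only [ControlNet.cell, Set.mem_ofPred_eq, pow_zero, one_smul] at hx ⊢
    rwa [smul_smul, mul_inv_cancel₀ (by positivity), one_smul]
  have h1 : Tendsto (fun k : ℕ => T.ring net d k l i (((2 : ℝ) ^ k)⁻¹ • x)) atTop (𝓝 p) := by
    rw [← tendsto_sub_nhds_zero_iff, tendsto_zero_iff_enorm_tendsto_zero]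
    refine tendsto_of_tendsto_of_tendsto_of_le_of_le tendsto_const_nhds hp (fun _ => zero_le)
      fun k => ?_
    exact le_iSup_of_le l (le_iSup_of_le i (le_iSup₂_of_le _ (hcell k) le_rfl))
  refine (tendsto_pi_nhds.1 h1 0).congr fun k => ?_
  have e1 : T.ring net d k l i (((2 : ℝ) ^ k)⁻¹ • x) = ∑ α ∈ nearby R x,
      φ (x - latticePoint α) • T.points d k (net.label l i α) := by
    rw [SubdivisionScheme.ring, smul_smul, mul_inv_cancel₀ (by positivity), one_smul,
      basicLimit_stationaryScheme h]
    exact finsum_eq_sum_of_support_subset _ fun α hα =>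
      support_translates_subset hφ x (left_ne_zero_of_smul hα)
  rw [e1, ringFunctional_apply, Finset.sum_apply]
  refine Finset.sum_congr rfl fun α _ => ?_
  rw [SubdivisionScheme.points, hT, matProd_stationaryScheme]
  rfl

/-- The powers of the local matrix of a convergent stationary scheme without ineffective
eigenvectors converge to a matrix with equal rows. -/
lemma exists_tendsto_blockCirculant_pow (hone : blockCirculant B *ᵥ 1 = 1)
    (heff : NoIneffectiveEigenvectors net c B)
    (h : (stationaryScheme (n := n) c B).IsLimit 1 deltaData φ)
    (hφ : ∀ x, R < ‖x‖ → φ x = 0) (hφ1 : limitOp φ 1 = 1)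
    (hirr : (stationaryScheme c B).ConvergentIrregular net) :
    ∃ w : ZMod n × Fin m → ℝ,
      Tendsto (fun k : ℕ => blockCirculant B ^ k) atTop (𝓝 (Matrix.of fun _ => w)) := by
  let σ := {s : ZMod n × Fin 3 × (ℝ × ℝ) // s.2.2 ∈ net.cell 0 s.2.1}
  refine exists_tendsto_pow (σ := σ) (blockCirculant B)
    (fun s => ringFunctional net φ R s.1.1 s.1.2.1 s.1.2.2) hone ?_ ?_ ?_
  · intro s
    have := congrFun hφ1 s.1.2.2
    rw [limitOp_eq_sum hφ 1 (Finset.Subset.refl _)] at this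
    rw [ringFunctional_apply]
    simpa using this
  · intro v
    obtain ⟨p, hp⟩ := exists_tendsto_ringFunctional h hφ hirr v
    exact ⟨p, fun s => hp _ _ _ s.2⟩
  · intro μ v hμ hv hev
    obtain ⟨l, i, x, hx, hne⟩ := heff μ v hμ hv hev
    refine ⟨⟨(l, i, x), hx⟩, ?_⟩
    by_contra! hzero
    refine hne ?_
    rw [basicLimit_stationaryScheme h]
    have hs : ∑ᶠ α : ℤ × ℤ, (φ (x - latticePoint α) : ℂ) * v (net.label l i α) =
        ∑ α ∈ nearby R x, (φ (x - latticePoint α) : ℂ) * v (net.label l i α) :=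
      finsum_eq_sum_of_support_subset _ fun α hα =>
        support_translates_subset hφ x (Complex.ofReal_ne_zero.1 (left_ne_zero_of_mul hα))
    rw [hs]
    have h1 := hzero.1
    have h2 := hzero.2
    rw [ringFunctional_apply] at h1 h2
    apply Complex.ext
    · simpa [Complex.re_sum] using h1
    · simpa [Complex.im_sum] using h2

end rings

/-! ### Convergence near the extraordinary element -/

theorem theorem1 (n m : ℕ) [NeZero n] (net : ControlNet n m)
    (S : SubdivisionScheme n m)
    (c : Mask) (B : ZMod n → Matrix (Fin m) (Fin m) ℝ) (C σ : ℝ)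
    (hS : S.NonSingular)
    -- standing assumptions on the stationary local matrix
    (hone : blockCirculant B *ᵥ (fun _ => (1 : ℝ)) = fun _ => 1)
    (heff : NoIneffectiveEigenvectors net c B)
    -- (i)
    (hreg : (stationaryScheme (n := n) (m := m) c B).ConvergentRegular)
    (hirr : (stationaryScheme (n := n) (m := m) c B).ConvergentIrregular net)
    -- (ii)
    (hequiv : S.AsymptoticallyEquivalent (stationaryScheme c B))
    -- (iii), with the matrix norm induced by the maximum norm
    (hσ : 1 < σ)
    (hmat : ∀ k : ℕ, 1 ≤ k → ‖S.mat k - blockCirculant B‖ ≤ C / σ ^ k) :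
    S.ConvergentIrregular net ∧
    ∃ x₀' : ZMod n × Fin m → ℝ,
      ((blockCirculant B)ᵀ *ᵥ x₀' = x₀' ∧ x₀' ⬝ᵥ (fun _ => 1) = 1 ∧
        ∀ w, (blockCirculant B)ᵀ *ᵥ w = w → w ⬝ᵥ (fun _ => 1) = 1 → w = x₀') ∧
      ∀ d : Matrix (ZMod n × Fin m) (Fin 3) ℝ,
        ∃ y : Matrix (ZMod n × Fin m) (Fin 3) ℝ,
          Tendsto (perturbation S (blockCirculant B) d) atTop (𝓝 y) ∧
          S.RingsTendTo net d
            (dᵀ *ᵥ x₀' + yᵀ *ᵥ (fun _ => 1 / ((n * m : ℕ) : ℝ))) := by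
  have hsum : Summable fun j => (S.mask (j + 1) - c).opNorm := hequiv
  obtain ⟨R, hR, hc, hSR⟩ : ∃ R : ℝ, 0 ≤ R ∧ c.SupportedIn R ∧
      ∀ k, 1 ≤ k → (S.mask k).SupportedIn R := by
    obtain ⟨A, hA⟩ := S.common_support
    obtain ⟨R, hR, h⟩ := Mask.exists_supportedIn (A ∪ c.support)
    exact ⟨R, hR, h c Finset.subset_union_right,
      fun k hk => h _ ((hA k hk).trans Finset.subset_union_left)⟩
  set φ := (stationaryScheme (n := n) (m := m) c B).basicLimit 1
  have h : (stationaryScheme c B).IsLimit 1 deltaData φ := hirr.2.1 1 le_rfl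
  have hφ : ∀ x, R < ‖x‖ → φ x = 0 := fun x hx => h.eq_zero_of_norm_gt hR (fun _ _ => hc) hx
  have hφ1 : limitOp φ 1 = 1 := by
    obtain ⟨f, g, -, hfg, hg⟩ := hreg.2
    exact limitOp_one hR hc h (subdiv_one hfg hg)
  obtain ⟨D, hD⟩ := exists_isLimit hR hc h hsum
  have hdelta : ∀ α, |deltaData α| ≤ 1 := fun α => by rw [deltaData]; split_ifs <;> simp
  have hbasic : ∀ k, S.IsLimit (k + 1) deltaData (S.basicLimit (k + 1)) := fun k =>
    SubdivisionScheme.isLimit_basicLimit ((hD k deltaData 1 hdelta).imp fun _ hg => hg.1)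
  have hclose : ∀ k x, |S.basicLimit (k + 1) x - φ x| ≤ D * maskTail S c k := by
    intro k x
    obtain ⟨g, hg, hle⟩ := hD k deltaData 1 hdelta
    rw [(hbasic k).unique hg]
    simpa [limitOp_deltaData] using hle x
  have hregS : S.ConvergentRegular := by
    refine ⟨fun f ⟨M, hM⟩ => (hD 0 f M hM).imp fun _ hg => hg.1,
      deltaData, _, ⟨1, hdelta⟩, hbasic 0, fun h0 => ?_⟩
    have := congrFun (hS deltaData ⟨1, hdelta⟩ (h0 ▸ hbasic 0)) 0
    simp [deltaData] at this
  obtain ⟨w, hw⟩ := exists_tendsto_blockCirculant_pow hone heff h hφ hφ1 hirr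
  have hmatsum : Summable fun j => ‖S.mat (j + 1) - blockCirculant B‖ := by
    have hσ0 : 0 < σ := one_pos.trans hσ
    have hgeo : Summable fun j : ℕ => C * (σ⁻¹) ^ (j + 1) :=
      ((summable_nat_add_iff 1).2
        (summable_geometric_of_lt_one (by positivity) (inv_lt_one_of_one_lt₀ hσ))).mul_left C
    refine Summable.of_nonneg_of_le (fun _ => norm_nonneg _) (fun j => ?_) hgeo
    rw [inv_pow, ← div_eq_mul_inv]
    exact hmat (j + 1) (Nat.le_add_left 1 j)
  obtain ⟨Z, hZ⟩ := exists_tendsto_perturbation (P := S.matProd) (s := S.mat) rfl (fun _ => rfl)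
    hw hmatsum
  have : Nonempty (ZMod n × Fin m) := ⟨net.pos 0 0⟩
  have hm : ((n * m : ℕ) : ℝ) ≠ 0 := by
    have : 0 < m := (net.pos 0 0).2.pos
    have := NeZero.ne n
    positivity
  have hlim : ∀ d : Matrix (ZMod n × Fin m) (Fin 3) ℝ,
      ∃ y : Matrix (ZMod n × Fin m) (Fin 3) ℝ,
        Tendsto (perturbation S (blockCirculant B) d) atTop (𝓝 y) ∧
        S.RingsTendTo net d
          (dᵀ *ᵥ w + yᵀ *ᵥ (fun _ => 1 / ((n * m : ℕ) : ℝ))) := by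
    intro d
    set L : Matrix (ZMod n × Fin m) (ZMod n × Fin m) ℝ := Matrix.of fun _ => w with hL
    have hcont : Continuous fun M : Matrix (ZMod n × Fin m) (ZMod n × Fin m) ℝ => M * d := by
      fun_prop
    have hy : Tendsto (perturbation S (blockCirculant B) d) atTop (𝓝 (L * Z * d)) :=
      ((hcont.tendsto _).comp hZ).congr fun k => (perturbation_eq_sum _ d k).symm
    have hpts : Tendsto (S.points d) atTop (𝓝 (L * d + L * Z * d)) :=
      (((hcont.tendsto _).comp hw).add hy).congr fun k => (points_eq_add_perturbation _ d k).symm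
    refine ⟨L * Z * d, hy, ringsTendTo_of_tendsto_points hR hφ h.1 hφ1
      (fun k x hx => (hbasic k).eq_zero_of_norm_gt hR
        (fun j hj => hSR j ((Nat.le_add_left 1 k).trans hj)) hx)
      (by simpa using (tendsto_maskTail S c).const_mul D) hclose fun q => ?_⟩
    have hrow : (L * d + L * Z * d) q =
        dᵀ *ᵥ w + (L * Z * d)ᵀ *ᵥ (fun _ => 1 / ((n * m : ℕ) : ℝ)) := by
      -- all rows of `L * Z * d` are equal, so averaging a column gives back its common entry
      have hconst : ∀ r j, (L * Z * d) r j = (L * Z * d) q j := by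
        intro r j
        rw [Matrix.mul_assoc]; rfl
      ext j
      have h1 : (L * d) q j = (dᵀ *ᵥ w) j := by
        simp [hL, Matrix.mul_apply, Matrix.mulVec, dotProduct, mul_comm]
      have h2 : ((L * Z * d)ᵀ *ᵥ (fun _ => 1 / ((n * m : ℕ) : ℝ))) j = (L * Z * d) q j := by
        simp only [Matrix.mulVec, dotProduct, Matrix.transpose_apply, hconst _ j,
          Finset.sum_const, Finset.card_univ, Fintype.card_prod, ZMod.card, Fintype.card_fin,
          nsmul_eq_mul]
        field_simp
      rw [Pi.add_apply, h2, ← h1]; rfl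
    rw [← hrow]
    exact tendsto_pi_nhds.1 hpts q
  refine ⟨⟨hregS, fun k hk => ?_, fun d => ?_⟩, w, fixedRow_of_tendsto_pow hone hw, hlim⟩
  · obtain ⟨k, rfl⟩ := Nat.exists_eq_add_of_le' hk
    exact hbasic k
  · obtain ⟨y, -, hy⟩ := hlim d
    exact ⟨_, hy⟩
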